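/- Let $M$ be a smooth manifold (Hausdorff, second countable, without boundary) of dimension $n$. Let $\mathbb TM=TM\oplus T^*M$ be its generalized tangent bundle, with sections $X+\alpha$, where $X$ is a vector field and $\alpha$ a $1$-form, with the inner product $$\langle X+\alpha,Y+\beta\rangle=\tfrac12\bigl(\alpha(Y)+\beta(X)\bigr)$$ and the Dorfman bracket $$[\![X+\alpha,Y+\beta]\!]=[X,Y]+\mathcal L_X\beta-\iota_Y d\alpha .$$ Let $\mathbb R$-linear operators on the differential forms $\Omega_M=\bigoplus_k\Omega^k_M$ carry the graded commutator $[\psi,\chi]=\psi\chi-(-1)^{kl}\chi\psi$ for $\psi,\chi$ of degrees $k,l$ (extended bilinearly). A section $X+\alpha$ of $\mathbb TM$ acts on $\Omega_M$ by $\omega\mapsto\iota_X\omega+\alpha\wedge\omega$ and a function acts by multiplication; we denote the operators by the same letters. Write $\mathrm{ad}_\psi=[\psi,\cdot\,]$. A bundle endomorphism $\varphi$ of $\mathbb TM$ is *skew-symmetric* if $\langle\varphi(\mathbf x),\mathbf y\rangle+\langle\mathbf x,\varphi(\mathbf y)\rangle=0$ for all sections $\mathbf x,\mathbf y$ of $\mathbb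 TM$. A *generalized polynomial structure* is a skew-symmetric $\varphi$ for which there is a monic polynomial $P\in\mathbb R[x]$ of positive degree that is the minimal polynomial of $\varphi_p:\mathbb T_pM\to\mathbb T_pM$ for every $p\in M$; $P$ is the minimal polynomial of $\varphi$. It is *semisimple* if every $\varphi_p$ is semisimple. The *Courant–Nijenhuis torsion* and the *shifted Courant–Nijenhuis torsion* of $\varphi$ are $$\mathcal T_\varphi(\mathbf x,\mathbf y)=\varphi^2[\![\mathbf x,\mathbf y]\!]+[\![\varphi\mathbf x,\varphi\mathbf y]\!]-\varphi\bigl([\![\varphi\mathbf x,\mathbf y]\!]+[\![\mathbf x,\varphi\mathbf y]\!]\bigr),\qquad \mathcal S_\varphi(\mathbf x,\mathbf y)=\mathcal T_\varphi(\varphi\mathbf x,\mathbf y)+\mathcal T_\varphi(\mathbf x,\varphi\mathbf y),$$ and $\varphi$ is a *weak generalized Nijenhuis operator* if $\mathcal S_\varphi=0$. A skew-symmetric $\varphi$ has a unique lift $\widetilde\varphi$, an even $\mathbb R$-linear operator on $\Omega_M$ such that $[\widetilde\varphi,f]=0$ for all functions $f$, $[\widetilde\varphi,\mathbf x]=\varphi(\mathbf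 x)$ for all sections $\mathbf x$ of $\mathbb TM$, and $\widetilde\varphi(1)\in\Omega^2_M$. For a generalized polynomial structure $\varphi$ with minimal polynomial $P$ the *minimal operator* is $\delta_\varphi=P(\mathrm{ad}_{\widetilde\varphi})(d)$, with $d$ the de Rham differential, and $\varphi$ is *minimal* if its minimal torsion $\mathcal M_\varphi(\mathbf x,\mathbf y)=[[\mathbf x,\delta_\varphi],\mathbf y]$ vanishes for all sections $\mathbf x,\mathbf y$ of $\mathbb TM$. **Proposition.** Let $\varphi$ be a semisimple generalized polynomial structure on $M$. If $\varphi$ is a weak generalized Nijenhuis operator, then $\varphi$ is minimal. -/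

import Mathlib

open scoped Manifold ContDiff Bundle
open VectorField

noncomputable section

namespace GeneralizedGeometry


/-- The algebra `C^∞(M)` of smooth real functions on the `n`-manifold `M`. -/
abbrev SmoothFunction (n : ℕ) (M : Type*) [TopologicalSpace M]
    [ChartedSpace (EuclideanSpace ℝ (Fin n)) M] : Type _ :=
  C^∞⟮𝓡 n, M; ℝ⟯

/-- The smooth vector fields on the `n`-manifold `M`. -/
abbrev SmoothVectorField (n : ℕ) (M : Type*) [TopologicalSpace M]
    [ChartedSpace (EuclideanSpace ℝ (Fin n)) M] [IsManifold (𝓡 n) ∞ M] : Type _ :=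
  Cₛ^∞⟮𝓡 n; EuclideanSpace ℝ (Fin n), (TangentSpace (𝓡 n) : M → Type _)⟯

section VectorFields
variable {n : ℕ} {M : Type*} [TopologicalSpace M]
  [ChartedSpace (EuclideanSpace ℝ (Fin n)) M] [IsManifold (𝓡 n) ∞ M]

/-- Pointwise multiplication of vector fields by functions. -/
instance instSMulVF : SMul (SmoothFunction n M) (SmoothVectorField n M) :=
  ⟨fun f X => ⟨fun p => f p • X p, f.contMDiff.smul_section X.contMDiff⟩⟩

@[simp] theorem smooth_smul_apply (f : SmoothFunction n M) (X : SmoothVectorField n M) (p : M) :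
    (f • X) p = f p • X p := rfl

instance instModuleVF : Module (SmoothFunction n M) (SmoothVectorField n M) where
  one_smul X := by ext p; simp
  mul_smul f g X := by ext p; simp [mul_smul]
  smul_zero f := by ext p; simp
  smul_add f X Y := by ext p; simp
  add_smul f g X := by ext p; simp [add_smul]
  zero_smul X := by ext p; simp

instance instIsScalarTowerVF : IsScalarTower ℝ (SmoothFunction n M) (SmoothVectorField n M) where
  smul_assoc r f X := by ext p; simp [mul_smul]

theorem contMDiff_dir (X : SmoothVectorField n M) (f : SmoothFunction n M) :
    ContMDiff (𝓡 n) 𝓘(ℝ, ℝ) ∞ (fun p : M => (mvfderiv (𝓡 n) f p (X p) : ℝ)) := by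
  have h := (f.contMDiff.contMDiff_tangentMap (m := ∞) (by simp)).comp X.contMDiff
  exact (contMDiff_snd_tangentBundle_modelSpace ℝ 𝓘(ℝ, ℝ)).comp h

instance instIsManifoldMinSmoothness (k : ℕ) : IsManifold (𝓡 n) (minSmoothness ℝ k) M := by
  rw [minSmoothness_of_isRCLikeNormedField]
  exact IsManifold.of_le (n := ∞) (by exact_mod_cast le_top)

theorem contMDiff_mlieBracket (X Y : SmoothVectorField n M) :
    ContMDiff (𝓡 n) ((𝓡 n).prod (𝓡 n)) ∞
      (fun p => (⟨p, mlieBracket (𝓡 n) X Y p⟩ : TangentBundle (𝓡 n) M)) := by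
  have : IsManifold (𝓡 n) (((⊤ : ℕ∞) : WithTop ℕ∞) + 1) M := by
    simpa using (inferInstance : IsManifold (𝓡 n) ∞ M)
  have : IsManifold (𝓡 n) (minSmoothness ℝ 2) M := instIsManifoldMinSmoothness 2
  exact ContDiff.mlieBracket_vectorField (m := ⊤) (n := ⊤) X.contMDiff Y.contMDiff (by simp)

/-- The Lie bracket of vector fields. -/
instance instBracketVF : Bracket (SmoothVectorField n M) (SmoothVectorField n M) :=
  ⟨fun X Y => ⟨mlieBracket (𝓡 n) X Y, contMDiff_mlieBracket X Y⟩⟩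

/-- The derivative `⁅X, f⁆ = X f` of a function along a vector field. -/
instance instBracketVFFunction : Bracket (SmoothVectorField n M) (SmoothFunction n M) :=
  ⟨fun X f => ⟨fun p => mvfderiv (𝓡 n) f p (X p), contMDiff_dir X f⟩⟩

theorem vf_bracket_apply (X Y : SmoothVectorField n M) (p : M) :
    ⁅X, Y⁆ p = mlieBracket (𝓡 n) X Y p := rfl

theorem vf_deriv_apply (X : SmoothVectorField n M) (f : SmoothFunction n M) (p : M) :
    ⁅X, f⁆ p = mvfderiv (𝓡 n) f p (X p) := rfl

theorem SmoothFunction.mdiffAt (f : SmoothFunction n M) (p : M) :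
    MDifferentiableAt (𝓡 n) 𝓘(ℝ, ℝ) f p := f.contMDiff.mdifferentiable (by simp) p

theorem vf_cmdiff (X : SmoothVectorField n M) (k : ℕ) (p : M) :
    ContMDiffAt (𝓡 n) ((𝓡 n).prod (𝓡 n)) (minSmoothness ℝ k)
      (fun q => (⟨q, X q⟩ : TangentBundle (𝓡 n) M)) p := by
  rw [minSmoothness_of_isRCLikeNormedField]
  exact (X.contMDiff p).of_le (by exact_mod_cast le_top)

instance instLieRingVF : LieRing (SmoothVectorField n M) where
  add_lie X Y Z := by
    ext p
    exact mlieBracket_add_left X.mdifferentiableAt Y.mdifferentiableAt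
  lie_add X Y Z := by
    ext p
    exact mlieBracket_add_right (V := X) Y.mdifferentiableAt Z.mdifferentiableAt
  lie_self X := by
    ext p
    rw [vf_bracket_apply, mlieBracket_self]; rfl
  leibniz_lie X Y Z := by
    ext p
    have : IsManifold (𝓡 n) (minSmoothness ℝ 3) M := instIsManifoldMinSmoothness 3
    exact leibniz_identity_mlieBracket_apply (vf_cmdiff X 2 p) (vf_cmdiff Y 2 p) (vf_cmdiff Z 2 p)

instance instLieAlgebraVF : LieAlgebra ℝ (SmoothVectorField n M) where
  lie_smul t X Y := by
    ext p
    exact mlieBracket_const_smul_right Y.mdifferentiableAt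

theorem vf_bracket_smul_local (X : SmoothVectorField n M) (f : SmoothFunction n M)
    (W : Π p : M, TangentSpace (𝓡 n) p) (p : M)
    (hW : MDifferentiableAt (𝓡 n) ((𝓡 n).prod (𝓡 n))
      (fun q => (⟨q, W q⟩ : TangentBundle (𝓡 n) M)) p) :
    mlieBracket (𝓡 n) X ((f : M → ℝ) • W) p = ⁅X, f⁆ p • W p + f p • mlieBracket (𝓡 n) X W p :=
  mlieBracket_smul_right (f.mdiffAt p) hW

theorem vf_bracket_bracket_smul_local (X Y : SmoothVectorField n M) (f : SmoothFunction n M)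
    (W : Π p : M, TangentSpace (𝓡 n) p) (p : M)
    (hW : ContMDiffAt (𝓡 n) ((𝓡 n).prod (𝓡 n)) ∞
      (fun q => (⟨q, W q⟩ : TangentBundle (𝓡 n) M)) p) :
    mlieBracket (𝓡 n) X (mlieBracket (𝓡 n) Y ((f : M → ℝ) • W)) p =
      (⁅X, ⁅Y, f⁆⁆ p • W p + ⁅Y, f⁆ p • mlieBracket (𝓡 n) X W p) +
        (⁅X, f⁆ p • mlieBracket (𝓡 n) Y W p +
          f p • mlieBracket (𝓡 n) X (mlieBracket (𝓡 n) Y W) p) := by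
  have : IsManifold (𝓡 n) (((⊤ : ℕ∞) : WithTop ℕ∞) + 1) M := by
    simpa using (inferInstance : IsManifold (𝓡 n) ∞ M)
  have : IsManifold (𝓡 n) (minSmoothness ℝ 2) M := instIsManifoldMinSmoothness 2
  have hB : ContMDiffAt (𝓡 n) ((𝓡 n).prod (𝓡 n)) ∞
      (fun q => (⟨q, mlieBracket (𝓡 n) Y W q⟩ : TangentBundle (𝓡 n) M)) p :=
    ContMDiffAt.mlieBracket_vectorField (m := ⊤) (n := ⊤) (Y.contMDiff p) hW (by simp)
  have hW1 := hW.mdifferentiableAt (by simp)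
  have hB1 := hB.mdifferentiableAt (by simp)
  have hev : mlieBracket (𝓡 n) Y ((f : M → ℝ) • W) =ᶠ[nhds p]
      ((⁅Y, f⁆ : SmoothFunction n M) : M → ℝ) • W + (f : M → ℝ) • mlieBracket (𝓡 n) Y W := by
    have h1 : ∀ᶠ q in nhds p, ContMDiffAt (𝓡 n) ((𝓡 n).prod (𝓡 n)) 1
        (fun q => (⟨q, W q⟩ : TangentBundle (𝓡 n) M)) q :=
      (contMDiffAt_iff_contMDiffAt_nhds (n := 1) (by simp)).1 (hW.of_le (by simp))
    filter_upwards [h1] with q hq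
    exact vf_bracket_smul_local Y f W q (hq.mdifferentiableAt (by simp))
  have hXX : (X : Π p : M, TangentSpace (𝓡 n) p) =ᶠ[nhds p] X := Filter.EventuallyEq.rfl
  rw [hXX.mlieBracket_vectorField_eq hev, mlieBracket_add_right,
    vf_bracket_smul_local X _ W p hW1, vf_bracket_smul_local X f _ p hB1]
  · exact (((⁅Y, f⁆ : SmoothFunction n M).contMDiff p).smul_section hW).mdifferentiableAt (by simp)
  · exact ((f.contMDiff p).smul_section hB).mdifferentiableAt (by simp)

theorem vf_leibniz (X Y : SmoothVectorField n M) (f : SmoothFunction n M) :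
    ⁅X, ⁅Y, f⁆⁆ = ⁅⁅X, Y⁆, f⁆ + ⁅Y, ⁅X, f⁆⁆ := by
  ext p
  by_cases h0 : ∀ v : TangentSpace (𝓡 n) p, v = 0
  · have h (Z : SmoothVectorField n M) (g : SmoothFunction n M) : ⁅Z, g⁆ p = 0 := by
      rw [vf_deriv_apply, h0 (Z p), map_zero]
    simp only [ContMDiffMap.coe_add, Pi.add_apply, h, add_zero]
  push Not at h0
  obtain ⟨v, hv⟩ := h0
  set Z : Π q : M, TangentSpace (𝓡 n) q := FiberBundle.extend (EuclideanSpace ℝ (Fin n)) v with hZ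
  have hZp : Z p = v := by simp [hZ]
  have hZs : ContMDiffAt (𝓡 n) ((𝓡 n).prod (𝓡 n)) ∞
      (fun q => (⟨q, Z q⟩ : TangentBundle (𝓡 n) M)) p :=
    FiberBundle.contMDiffAt_extend (k := ∞) (𝓡 n) (EuclideanSpace ℝ (Fin n)) v
  have : IsManifold (𝓡 n) (minSmoothness ℝ 3) M := instIsManifoldMinSmoothness 3
  have hle : minSmoothness ℝ 2 ≤ ∞ := by
    rw [minSmoothness_of_isRCLikeNormedField]
    exact WithTop.coe_le_coe.2 le_top
  have j1 := leibniz_identity_mlieBracket_apply (vf_cmdiff X 2 p) (vf_cmdiff Y 2 p)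
    (((f.contMDiff p).smul_section hZs).of_le hle)
  have j2 := leibniz_identity_mlieBracket_apply (vf_cmdiff X 2 p) (vf_cmdiff Y 2 p)
    (hZs.of_le hle)
  have e1 := vf_bracket_bracket_smul_local X Y f Z p hZs
  have e2 := vf_bracket_bracket_smul_local Y X f Z p hZs
  have e3 := vf_bracket_smul_local ⁅X, Y⁆ f Z p (hZs.mdifferentiableAt (by simp))
  change mlieBracket (𝓡 n) (mlieBracket (𝓡 n) X Y) _ p =
    _ • _ + _ • mlieBracket (𝓡 n) (mlieBracket (𝓡 n) X Y) _ p at e3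
  have key : (⁅X, ⁅Y, f⁆⁆ p - ⁅⁅X, Y⁆, f⁆ p - ⁅Y, ⁅X, f⁆⁆ p) • v = 0 := by
    rw [e1, e2, e3, j2, hZp] at j1
    rw [sub_smul, sub_smul]
    rw [← sub_eq_zero] at j1
    rw [← j1, smul_add]
    abel
  rcases smul_eq_zero.1 key with h | h
  · simp only [ContMDiffMap.coe_add, Pi.add_apply]
    linarith
  · exact absurd h hv

instance instLieRingModuleVF : LieRingModule (SmoothVectorField n M) (SmoothFunction n M) where
  add_lie X Y f := by
    ext p
    exact map_add (mvfderiv (𝓡 n) f p) (X p) (Y p)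
  lie_add X f g := by
    ext p
    exact congrArg (· (X p)) (mvfderiv_add (f.mdiffAt p) (g.mdiffAt p))
  leibniz_lie := vf_leibniz

instance instLieRinehartRingVF : LieRinehartRing (SmoothFunction n M) (SmoothVectorField n M) where
  lie_smul_eq_mul' a b X := by
    ext p
    exact map_smul (mvfderiv (𝓡 n) b p) (a p) (X p)
  leibniz_mul_right' X a b := by
    ext p
    have := congrArg (· (X p)) (mvfderiv_mul (a.mdiffAt p) (b.mdiffAt p))
    have h2 : ⁅X, a * b⁆ p = a p * ⁅X, b⁆ p + b p * ⁅X, a⁆ p := this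
    rw [h2, mul_comm (b p)]
    rfl
  leibniz_smul_right' X Y a := by
    ext p
    refine (vf_bracket_smul_local X a Y p Y.mdifferentiableAt).trans (add_comm _ _)

theorem lie_const_smul (t : ℝ) (X : SmoothVectorField n M) (f : SmoothFunction n M) :
    ⁅X, t • f⁆ = t • ⁅X, f⁆ := by
  ext p
  have := congrArg (· (X p)) (mvfderiv_smul (mdifferentiableAt_const (c := t)) (f.mdiffAt p))
  simp only [mvfderiv_const] at this
  refine this.trans ?_
  simp [vf_deriv_apply]

instance instLieRinehartAlgebraVF : LieRinehartAlgebra ℝ (SmoothFunction n M) (SmoothVectorField n M) where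
  smul_lie t X f := by
    ext p
    exact map_smul (mvfderiv (𝓡 n) f p) t (X p)
  lie_smul t X f := by
    exact lie_const_smul t X f
end VectorFields

/-- Differential forms of degree `k` over a Lie-Rinehart pair `(A, L)`: `A`-multilinear alternating
maps `L × ⋯ × L → A`.  For `A = C^∞(M)` and `L` the vector fields on `M` these are the differential
`k`-forms on `M`. -/
abbrev DForm (A L : Type*) [CommRing A] [AddCommGroup L] [Module A L] (k : ℕ) : Type _ :=
  L [⋀^Fin k]→ₗ[A] A

section Cartan
variable {A L : Type*} [CommRing A] [Algebra ℝ A] [LieRing L] [LieAlgebra ℝ L] [Module A L]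
  [LieRingModule L A] [LieRinehartRing A L] [LieRinehartAlgebra ℝ A L]

namespace DForm

theorem map_update_smul_real {k : ℕ} (θ : DForm A L k) (v : Fin k → L) (j : Fin k) (c : ℝ)
    (x : L) :
    θ (Function.update v j (c • x)) = c • θ (Function.update v j x) := by
  rw [← algebraMap_smul A c x, θ.map_update_smul, algebraMap_smul]

/-- The alternating map `v ↦ X (θ v) - (1/2) ∑ j, θ (v 0, …, [X, v j], …)`, an auxiliary step in the
construction of the exterior derivative. -/
def preDerivAlt {k : ℕ} (θ : DForm A L k) (X : L) : L [⋀^Fin k]→ₗ[ℝ] A where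
  toFun v := ⁅X, θ v⁆ - (1 / 2 : ℝ) • ∑ j : Fin k, θ (Function.update v j ⁅X, v j⁆)
  map_update_add' := by
    intro inst m i x y
    obtain rfl : inst = instDecidableEqFin k := Subsingleton.elim _ _
    have h : ∑ j : Fin k, θ (Function.update (Function.update m i (x + y)) j
          ⁅X, Function.update m i (x + y) j⁆) =
        ∑ j : Fin k, θ (Function.update (Function.update m i x) j ⁅X, Function.update m i x j⁆) +
        ∑ j : Fin k, θ (Function.update (Function.update m i y) j
          ⁅X, Function.update m i y j⁆) := by
      rw [← Finset.sum_add_distrib]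
      refine Finset.sum_congr rfl fun j _ => ?_
      rcases eq_or_ne j i with rfl | h
      · simp
      · simp [h, Function.update_comm h.symm]
    rw [h, θ.map_update_add, lie_add, smul_add]
    abel
  map_update_smul' := by
    intro inst m i c x
    obtain rfl : inst = instDecidableEqFin k := Subsingleton.elim _ _
    have h : ∑ j : Fin k, θ (Function.update (Function.update m i (c • x)) j
          ⁅X, Function.update m i (c • x) j⁆) =
        c • ∑ j : Fin k, θ (Function.update (Function.update m i x) j
          ⁅X, Function.update m i x j⁆) := by
      rw [Finset.smul_sum]
      refine Finset.sum_congr rfl fun j _ => ?_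
      rcases eq_or_ne j i with rfl | h
      · simp [map_update_smul_real]
      · simp [h, Function.update_comm h.symm, map_update_smul_real]
    rw [h, map_update_smul_real, lie_smul, smul_sub, smul_comm c]
  map_eq_zero_of_eq' := by
    intro v i j hij hne
    have h : ∑ j : Fin k, θ (Function.update v j ⁅X, v j⁆) = 0 := by
      rw [Fintype.sum_eq_add i j hne]
      · rw [← hij]
        have := θ.map_swap (Function.update v j ⁅X, v i⁆) hne
        rw [← add_eq_zero_iff_eq_neg] at this
        rw [← this]
        congr 2
        ext l
        rcases eq_or_ne l i with rfl | hi
        · simp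
        rcases eq_or_ne l j with rfl | hj
        · simp [hij, hne, hi]
        · simp [hi, hj, Equiv.swap_apply_of_ne_of_ne hi hj]
      · intro l ⟨hi, hj⟩
        exact θ.map_eq_zero_of_eq _ (by simp [hi.symm, hj.symm, hij]) hne
    rw [h, θ.map_eq_zero_of_eq v hij hne]
    simp

/-- `preDerivAlt θ X` as a linear map in `X`. -/
def preDeriv {k : ℕ} (θ : DForm A L k) : L →ₗ[ℝ] L [⋀^Fin k]→ₗ[ℝ] A where
  toFun X := preDerivAlt θ X
  map_add' X Y := by
    ext v
    simp [preDerivAlt, Finset.sum_add_distrib]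
    abel
  map_smul' c X := by
    ext v
    simp [preDerivAlt, map_update_smul_real, ← Finset.smul_sum, smul_sub, smul_comm c]

theorem preDeriv_apply {k : ℕ} (θ : DForm A L k) (X : L) (v : Fin k → L) :
    preDeriv θ X v = ⁅X, θ v⁆ - (1 / 2 : ℝ) • ∑ j : Fin k, θ (Function.update v j ⁅X, v j⁆) := rfl

theorem smul_lie_eq (c : A) (x y : L) : ⁅c • x, y⁆ = c • ⁅x, y⁆ - ⁅y, c⁆ • x := by
  rw [← lie_skew, LieRinehartRing.leibniz_smul_right, ← lie_skew x y, smul_neg]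
  abel

theorem preDeriv_smul_left {k : ℕ} (θ : DForm A L k) (X : L) (c : A) (v : Fin k → L) :
    preDeriv θ (c • X) v = c • preDeriv θ X v +
      (1 / 2 : ℝ) • ∑ j : Fin k, ⁅v j, c⁆ * θ (Function.update v j X) := by
  simp only [preDeriv_apply, smul_lie_eq, LieRinehartRing.lie_smul_eq_mul,
    AlternatingMap.map_update_sub, AlternatingMap.map_update_smul, Finset.sum_sub_distrib,
    smul_sub, smul_eq_mul, ← Finset.mul_sum, mul_sub, Algebra.mul_smul_comm]
  abel

theorem preDeriv_smul_right {k : ℕ} (θ : DForm A L k) (X : L) (c : A) (v : Fin k → L)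
    (i : Fin k) (x : L) :
    preDeriv θ X (Function.update v i (c • x)) = c • preDeriv θ X (Function.update v i x) +
      (1 / 2 : ℝ) • (⁅X, c⁆ * θ (Function.update v i x)) := by
  have h : ∑ j : Fin k, θ (Function.update (Function.update v i (c • x)) j
          ⁅X, Function.update v i (c • x) j⁆) =
        c • ∑ j : Fin k, θ (Function.update (Function.update v i x) j
          ⁅X, Function.update v i x j⁆) + ⁅X, c⁆ * θ (Function.update v i x) := by
    have : ⁅X, c⁆ * θ (Function.update v i x) =
        ∑ j : Fin k, if j = i then ⁅X, c⁆ * θ (Function.update v i x) else 0 := by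
      simp
    rw [this, Finset.smul_sum, ← Finset.sum_add_distrib]
    refine Finset.sum_congr rfl fun j _ => ?_
    rcases eq_or_ne j i with rfl | h
    · simp [LieRinehartRing.leibniz_smul_right]
    · simp [h, Function.update_comm h.symm]
  rw [preDeriv_apply, preDeriv_apply, h, θ.map_update_smul, smul_eq_mul,
    LieRinehartRing.leibniz_mul_right, smul_add, smul_sub, smul_comm c (1 / 2 : ℝ)]
  have : ⁅X, c⁆ * θ (Function.update v i x) =
      (1 / 2 : ℝ) • (⁅X, c⁆ * θ (Function.update v i x)) +
        (1 / 2 : ℝ) • (⁅X, c⁆ * θ (Function.update v i x)) := by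
    rw [← add_smul]; norm_num
  nth_rewrite 1 [this]
  abel

theorem alt_smul {k : ℕ} (θ : DForm A L k) (v : Fin (k + 1) → L) (i : Fin (k + 1)) (c : A)
    (x : L) :
    AlternatingMap.alternatizeUncurryFin (preDeriv θ) (Function.update v i (c • x)) =
      c • AlternatingMap.alternatizeUncurryFin (preDeriv θ) (Function.update v i x) := by
  have h2 (j : Fin k) :
      (-1) ^ (i.succAbove j : ℕ) • preDeriv θ (Function.update v i (c • x) (i.succAbove j))
          ((i.succAbove j).removeNth (Function.update v i (c • x))) =
        c • ((-1) ^ (i.succAbove j : ℕ) • preDeriv θ (Function.update v i x (i.succAbove j))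
          ((i.succAbove j).removeNth (Function.update v i x))) -
        (-1) ^ (i : ℕ) • (1 / 2 : ℝ) •
          (⁅i.removeNth v j, c⁆ * θ (Function.update (i.removeNth v) j x)) := by
    have hne := Fin.succAbove_ne i j
    obtain ⟨l, hl⟩ := Fin.exists_succAbove_eq hne.symm
    have hr (y : L) : (i.succAbove j).removeNth (Function.update v i y) =
        Function.update ((i.succAbove j).removeNth v) l y := by
      have := Fin.removeNth_update_succAbove (i.succAbove j) l y v
      rwa [hl] at this
    have key := θ.neg_one_pow_smul_map_removeNth_add_eq_zero_of_eq
      (v := Function.update (Function.update v i x) (i.succAbove j) x) (i := i.succAbove j)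
      (j := i) (by simp) hne
    rw [Fin.removeNth_update, hr, Fin.removeNth_update_succAbove, Fin.removeNth_update,
      add_eq_zero_iff_eq_neg] at key
    rw [hr, hr, preDeriv_smul_right, Function.update_of_ne hne, Function.update_of_ne hne,
      smul_add, smul_comm c, sub_eq_add_neg]
    congr 1
    rw [smul_comm _ (1 / 2 : ℝ), smul_comm _ (1 / 2 : ℝ), ← mul_smul_comm, key, mul_neg, smul_neg,
      mul_smul_comm]
    rfl
  rw [AlternatingMap.alternatizeUncurryFin_apply, AlternatingMap.alternatizeUncurryFin_apply,
    Fin.sum_univ_succAbove _ i, Fin.sum_univ_succAbove _ i]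
  simp only [h2, Fin.removeNth_update, Function.update_self, preDeriv_smul_left, smul_add,
    Finset.sum_sub_distrib, Finset.smul_sum]
  rw [smul_comm c ((-1) ^ (i : ℕ))]
  abel

/-- The exterior derivative (Koszul formula).  In the sum over `i` and `j` every unordered pair of
distinct arguments occurs twice, which accounts for the factor `1/2`; see `extDeriv_apply` for the
formula that sums over the pairs once, and `cartan` for Cartan's formula. -/
def extDeriv {k : ℕ} (θ : DForm A L k) : DForm A L (k + 1) where
  toFun v := ∑ i : Fin (k + 1), (-1) ^ (i : ℕ) • (⁅v i, θ (i.removeNth v)⁆ -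
    (1 / 2 : ℝ) • ∑ j : Fin k,
      θ (Function.update (i.removeNth v) j ⁅v i, i.removeNth v j⁆))
  map_update_add' := by
    intro inst v i x y
    obtain rfl : inst = instDecidableEqFin _ := Subsingleton.elim _ _
    simpa only [AlternatingMap.alternatizeUncurryFin_apply, preDeriv_apply] using
      (AlternatingMap.alternatizeUncurryFin (preDeriv θ)).map_update_add v i x y
  map_update_smul' := by
    intro inst v i c x
    obtain rfl : inst = instDecidableEqFin _ := Subsingleton.elim _ _
    simpa only [AlternatingMap.alternatizeUncurryFin_apply, preDeriv_apply] using
      alt_smul θ v i c x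
  map_eq_zero_of_eq' := by
    intro v i j hij hne
    simpa only [AlternatingMap.alternatizeUncurryFin_apply, preDeriv_apply] using
      (AlternatingMap.alternatizeUncurryFin (preDeriv θ)).map_eq_zero_of_eq v hij hne

theorem extDeriv_eq_half {k : ℕ} (θ : DForm A L k) (v : Fin (k + 1) → L) :
    extDeriv θ v = ∑ i : Fin (k + 1), (-1) ^ (i : ℕ) • (⁅v i, θ (i.removeNth v)⁆ -
    (1 / 2 : ℝ) • ∑ j : Fin k,
      θ (Function.update (i.removeNth v) j ⁅v i, i.removeNth v j⁆)) := rfl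

theorem extDeriv_add {k : ℕ} (θ η : DForm A L k) :
    extDeriv (θ + η) = extDeriv θ + extDeriv η := by
  ext v
  simp only [extDeriv_eq_half, AlternatingMap.add_apply, lie_add, ← Finset.sum_add_distrib]
  refine Finset.sum_congr rfl fun i _ => ?_
  simp only [Finset.sum_add_distrib, smul_add, smul_sub]
  abel

theorem extDeriv_smul {k : ℕ} (c : ℝ) (θ : DForm A L k) :
    extDeriv (c • θ) = c • extDeriv θ := by
  ext v
  simp only [extDeriv_eq_half, AlternatingMap.smul_apply, lie_smul, ← Finset.smul_sum,
    smul_comm (1 / 2 : ℝ) c, ← smul_sub, smul_comm _ c]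

theorem removeNth_succ_cons {L : Type*} {k : ℕ} (X : L) (v : Fin (k + 1) → L) (s : Fin (k + 1)) :
    s.succ.removeNth (Fin.cons X v : Fin (k + 2) → L) = Fin.cons X (s.removeNth v) := by
  ext j
  refine Fin.cases ?_ (fun j => ?_) j <;> simp [Fin.removeNth]

theorem removeNth_zero_cons {L : Type*} {k : ℕ} (X : L) (v : Fin k → L) :
    (0 : Fin (k + 1)).removeNth (Fin.cons X v : Fin (k + 1) → L) = v := by
  ext j; simp [Fin.removeNth]

/-- Cartan's formula `ι_X d = L_X - d ι_X`. -/
theorem cartan {k : ℕ} (θ : DForm A L (k + 1)) (X : L) (v : Fin (k + 1) → L) :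
    extDeriv θ (Fin.cons X v) =
      ⁅X, θ v⁆ - ∑ j, θ (Function.update v j ⁅X, v j⁆) - extDeriv (θ.curryLeft X) v := by
  have h3 (s : Fin (k + 1)) : (-1) ^ (s : ℕ) • θ (Fin.cons ⁅v s, X⁆ (s.removeNth v)) =
      - θ (Function.update v s ⁅X, v s⁆) := by
    have := θ.map_insertNth s ⁅v s, X⁆ (s.removeNth v)
    rw [Fin.insertNth_removeNth, ← lie_skew, AlternatingMap.map_update_neg] at this
    rw [← lie_skew]
    exact this.symm
  have hc (w : Fin k → L) : θ.curryLeft X w = θ (Fin.cons X w) := rfl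
  have hs (s : Fin (k + 1)) :
      (-1) ^ (s.succ : ℕ) • (⁅v s, θ (Fin.cons X (s.removeNth v))⁆ -
        (1 / 2 : ℝ) • ∑ j : Fin (k + 1), θ (Function.update (Fin.cons X (s.removeNth v)) j
          ⁅v s, (Fin.cons X (s.removeNth v) : Fin (k + 1) → L) j⁆)) =
      - ((-1) ^ (s : ℕ) • (⁅v s, θ (Fin.cons X (s.removeNth v))⁆ -
        (1 / 2 : ℝ) • ∑ j : Fin k, θ (Fin.cons X (Function.update (s.removeNth v) j
          ⁅v s, s.removeNth v j⁆)))) - (1 / 2 : ℝ) • θ (Function.update v s ⁅X, v s⁆) := by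
    have h5 := h3 s
    rw [eq_neg_iff_add_eq_zero, add_comm, ← eq_neg_iff_add_eq_zero] at h5
    rw [h5, Fin.sum_univ_succ]
    simp only [Fin.cons_zero, Fin.cons_succ, Fin.update_cons_zero, ← Fin.cons_update,
      Fin.val_succ, pow_succ', mul_smul, smul_add, smul_sub, smul_neg,
      smul_comm (1 / 2 : ℝ) ((-1) ^ (s : ℕ)), neg_one_smul]
    abel
  rw [extDeriv_eq_half, Fin.sum_univ_succ, extDeriv_eq_half]
  simp only [removeNth_zero_cons, removeNth_succ_cons, Fin.cons_zero, Fin.cons_succ, Fin.val_zero,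
    pow_zero, one_smul, hc, hs, Finset.sum_sub_distrib, Finset.sum_neg_distrib, ← Finset.smul_sum]
  module

theorem extDeriv_zero (f : A) (v : Fin 1 → L) :
    extDeriv (AlternatingMap.constOfIsEmpty A L (Fin 0) f) v = ⁅v 0, f⁆ := by
  simp [extDeriv_eq_half]

/-- The Koszul formula
`dθ(v 0, …, v k) = ∑ i, (-1)^i v i (θ(…, v̂ i, …)) + ∑ i < j, (-1)^(i+j) θ([v i, v j], …, v̂ i, …, v̂ j, …)`,
where the bracket `[v i, v j]` is written in the slot of `v j` instead of in front. -/
theorem extDeriv_apply {k : ℕ} (θ : DForm A L k) (v : Fin (k + 1) → L) :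
    extDeriv θ v = ∑ i : Fin (k + 1), (-1) ^ (i : ℕ) • (⁅v i, θ (i.removeNth v)⁆ -
     ∑ j ∈ Finset.univ.filter (fun j : Fin k => (i : ℕ) ≤ (j : ℕ)),
      θ (Function.update (i.removeNth v) j ⁅v i, i.removeNth v j⁆)) := by
  induction k with
  | zero => simp [extDeriv_eq_half]
  | succ k ih =>
    obtain ⟨X, v, rfl⟩ : ∃ X w, v = Fin.cons X w := ⟨v 0, Fin.tail v, (Fin.cons_self_tail v).symm⟩
    have hc (w : Fin k → L) : θ.curryLeft X w = θ (Fin.cons X w) := rfl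
    have hs (s : Fin (k + 1)) :
        (-1) ^ (s.succ : ℕ) • (⁅v s, θ (Fin.cons X (s.removeNth v))⁆ -
          ∑ j ∈ Finset.univ.filter (fun j : Fin (k + 1) => (s.succ : ℕ) ≤ (j : ℕ)),
            θ (Function.update (Fin.cons X (s.removeNth v)) j
              ⁅v s, (Fin.cons X (s.removeNth v) : Fin (k + 1) → L) j⁆)) =
        - ((-1) ^ (s : ℕ) • (⁅v s, θ (Fin.cons X (s.removeNth v))⁆ -
          ∑ j ∈ Finset.univ.filter (fun j : Fin k => (s : ℕ) ≤ (j : ℕ)),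
            θ (Fin.cons X (Function.update (s.removeNth v) j ⁅v s, s.removeNth v j⁆)))) := by
      rw [Finset.sum_filter, Finset.sum_filter, Fin.sum_univ_succ]
      simp only [Fin.cons_succ, ← Fin.cons_update, Fin.val_succ, Fin.val_zero, pow_succ',
        mul_smul, neg_one_smul, add_le_add_iff_right, Nat.le_zero, Nat.add_eq_zero_iff,
        one_ne_zero, and_false, if_false, zero_add]
    rw [cartan, ih, Fin.sum_univ_succ (n := k + 1), sub_eq_add_neg, ← Finset.sum_neg_distrib]
    simp only [removeNth_zero_cons, removeNth_succ_cons, Fin.cons_zero, Fin.cons_succ,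
      Fin.val_zero, pow_zero, one_smul, hc, hs, Nat.zero_le, Finset.filter_true]
end DForm
end Cartan

section Operators

/-- All differential forms: families of forms of degrees `0, 1, 2, …`.  (Forms of degree larger than
the dimension of the manifold vanish, so this is the direct sum of the spaces of `k`-forms.) -/
def Forms (A L : Type*) [CommRing A] [AddCommGroup L] [Module A L] : Type _ :=
  ∀ k : ℕ, DForm A L k

instance Forms.instAddCommGroup (A L : Type*) [CommRing A] [AddCommGroup L] [Module A L] :
    AddCommGroup (Forms A L) :=
  inferInstanceAs (AddCommGroup (∀ k : ℕ, DForm A L k))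

instance Forms.instModule (A L : Type*) [CommRing A] [AddCommGroup L] [Module A L]
    [Algebra ℝ A] : Module ℝ (Forms A L) :=
  inferInstanceAs (Module ℝ (∀ k : ℕ, DForm A L k))

section FormsBasics
variable {A L : Type*} [CommRing A] [AddCommGroup L] [Module A L]

/-- The form with prescribed homogeneous components. -/
def Forms.mk (θ : ∀ k : ℕ, DForm A L k) : Forms A L := θ

/-- The component of degree `k`. -/
def Forms.component (θ : Forms A L) (k : ℕ) : DForm A L k := θ k

theorem Forms.ext {θ η : Forms A L} (h : ∀ k, θ.component k = η.component k) : θ = η := funext h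

@[simp] theorem Forms.component_mk (θ : ∀ k : ℕ, DForm A L k) (k : ℕ) :
    (Forms.mk θ).component k = θ k := rfl

@[simp] theorem Forms.component_add (θ η : Forms A L) (k : ℕ) :
    (θ + η).component k = θ.component k + η.component k := rfl

@[simp] theorem Forms.component_smul [Algebra ℝ A] (c : ℝ) (θ : Forms A L) (k : ℕ) :
    (c • θ).component k = c • θ.component k := rfl

/-- The constant function `1`, as a form of degree `0`. -/
def constOne : Forms A L :=
  Forms.mk fun k => match k with
    | 0 => AlternatingMap.constOfIsEmpty A L (Fin 0) 1
    | _ + 1 => 0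

end FormsBasics

variable (A L : Type*) [CommRing A] [Algebra ℝ A] [LieRing L] [LieAlgebra ℝ L] [Module A L]
  [LieRingModule L A] [LieRinehartRing A L] [LieRinehartAlgebra ℝ A L]

/-- The algebra of `ℝ`-linear operators on differential forms. -/
abbrev Operator : Type _ := Module.End ℝ (Forms A L)

/-- Sections of the generalized tangent bundle: pairs `(X, α)`, standing for `X + α`, of a vector
field and a `1`-form. -/
abbrev GenTangent : Type _ := L × Module.Dual A L

/-- The de Rham differential as an operator on forms. -/
def deRham : Operator A L where
  toFun θ := Forms.mk fun k => match k with
    | 0 => 0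
    | k + 1 => DForm.extDeriv (θ.component k)
  map_add' θ η := Forms.ext fun k => by
    cases k with
    | zero => simp
    | succ k => simp [DForm.extDeriv_add]
  map_smul' c θ := Forms.ext fun k => by
    cases k with
    | zero => simp
    | succ k => simp [DForm.extDeriv_smul]

variable {A L}

/-- Multiplication of forms by a function. -/
def mulFunction (f : A) : Operator A L where
  toFun θ := Forms.mk fun k => f • θ.component k
  map_add' θ η := Forms.ext fun k => by simp
  map_smul' c θ := Forms.ext fun k => by simp [smul_comm f c]

/-- Contraction of forms with a vector field. -/
def contraction (X : L) : Operator A L where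
  toFun θ := Forms.mk fun k => (θ.component (k + 1)).curryLeft X
  map_add' θ η := Forms.ext fun k => by simp
  map_smul' c θ := Forms.ext fun k => by
    ext v
    simp

/-- Left exterior multiplication by a `1`-form:
`(α ∧ θ)(v 0, …, v k) = ∑ i, (-1)^i α(v i) θ(…, v̂ i, …)`. -/
def wedge (α : Module.Dual A L) : Operator A L where
  toFun θ := Forms.mk fun k => match k with
    | 0 => 0
    | k + 1 => AlternatingMap.alternatizeUncurryFin (LinearMap.smulRight α (θ.component k))
  map_add' θ η := Forms.ext fun k => by
    cases k with
    | zero => simp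
    | succ k =>
      ext v
      simp [AlternatingMap.alternatizeUncurryFin_apply, Finset.sum_add_distrib]
  map_smul' c θ := Forms.ext fun k => by
    cases k with
    | zero => simp
    | succ k =>
      ext v
      simp [AlternatingMap.alternatizeUncurryFin_apply, Finset.smul_sum]

/-- The operator on forms given by a section `X + α` of the generalized tangent bundle: contraction
with `X` plus exterior multiplication by `α`. -/
def clifford (x : GenTangent A L) : Operator A L := contraction x.1 + wedge x.2

/-- The parity operator, `(-1)^k` on `k`-forms. -/
def parity : Operator A L where
  toFun θ := Forms.mk fun k => (-1 : ℝ) ^ k • θ.component k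
  map_add' θ η := Forms.ext fun k => by simp
  map_smul' c θ := Forms.ext fun k => by simp [smul_comm c]

/-- An operator is even if it preserves the parity of the degree of forms. -/
def IsEven (B : Operator A L) : Prop := parity * B = B * parity

/-- The odd part of an operator with respect to the parity of the degree of forms. -/
def oddPart (B : Operator A L) : Operator A L := (1 / 2 : ℝ) • (B - parity * B * parity)

theorem oddPart_add (B C : Operator A L) : oddPart (B + C) = oddPart B + oddPart C := by
  simp only [oddPart, mul_add, add_mul, ← smul_add]
  congr 1
  abel

theorem oddPart_smul (c : ℝ) (B : Operator A L) : oddPart (c • B) = c • oddPart B := by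
  simp only [oddPart, mul_smul_comm, smul_mul_assoc, ← smul_sub, smul_comm c (1 / 2 : ℝ)]

/-- The graded commutator `[C, B]` of operators on forms.  It is `C B - B C`, except that the odd
parts `C₁` and `B₁` contribute `C₁ B₁ + B₁ C₁`. -/
def gradedCommutator (C B : Operator A L) : Operator A L :=
  C * B - B * C + (2 : ℝ) • (oddPart B * oddPart C)

/-- The adjoint action `ad_C = [C, ·]` on operators. -/
def gradedAd (C : Operator A L) : Module.End ℝ (Operator A L) where
  toFun B := gradedCommutator C B
  map_add' B B' := by
    simp only [gradedCommutator, oddPart_add, mul_add, add_mul, smul_add]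
    abel
  map_smul' c B := by
    simp only [gradedCommutator, oddPart_smul, mul_smul_comm, smul_mul_assoc, smul_add, smul_sub,
      smul_comm (2 : ℝ) c, RingHom.id_apply]

/-- The derived bracket `[[B, δ], C]`. -/
def derivedBracket (δ B C : Operator A L) : Operator A L :=
  gradedCommutator (gradedCommutator B δ) C

/-- The tautological inner product `⟨X + α, Y + β⟩ = (α(Y) + β(X)) / 2`. -/
def pairing (x y : GenTangent A L) : A := (1 / 2 : ℝ) • (x.2 y.1 + y.2 x.1)

/-- The Lie derivative of a `1`-form, `(L_X β)(Z) = X(β(Z)) - β([X, Z])`. -/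
def lieDerivative (X : L) (β : Module.Dual A L) : Module.Dual A L where
  toFun Z := ⁅X, β Z⁆ - β ⁅X, Z⁆
  map_add' Z W := by
    simp only [map_add, lie_add]
    abel
  map_smul' f Z := by
    simp only [map_smul, smul_eq_mul, LieRinehartRing.leibniz_mul_right,
      LieRinehartRing.leibniz_smul_right, map_add, RingHom.id_apply]
    ring

/-- The contraction `ι_Y dα` of the exterior derivative of a `1`-form,
`(ι_Y dα)(Z) = Y(α(Z)) - Z(α(Y)) - α([Y, Z])`. -/
def contractDeriv (Y : L) (α : Module.Dual A L) : Module.Dual A L where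
  toFun Z := ⁅Y, α Z⁆ - ⁅Z, α Y⁆ - α ⁅Y, Z⁆
  map_add' Z W := by
    simp only [map_add, lie_add, add_lie]
    abel
  map_smul' f Z := by
    simp only [map_smul, smul_eq_mul, LieRinehartRing.leibniz_mul_right,
      LieRinehartRing.leibniz_smul_right, LieRinehartRing.lie_smul_eq_mul, map_add,
      RingHom.id_apply]
    ring

/-- The Dorfman bracket `[X + α, Y + β] = [X, Y] + L_X β - ι_Y dα`. -/
def dorfman (x y : GenTangent A L) : GenTangent A L :=
  (⁅x.1, y.1⁆, lieDerivative x.1 y.2 - contractDeriv y.1 x.2)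

/-- Skew-symmetry with respect to the tautological inner product. -/
def IsSkew (φ : Module.End A (GenTangent A L)) : Prop :=
  ∀ x y, pairing (φ x) y + pairing x (φ y) = 0

/-- The Courant-Nijenhuis torsion. -/
def courantNijenhuis (φ : Module.End A (GenTangent A L)) (x y : GenTangent A L) :
    GenTangent A L :=
  φ (φ (dorfman x y)) + dorfman (φ x) (φ y) - φ (dorfman (φ x) y + dorfman x (φ y))

/-- The shifted Courant-Nijenhuis torsion. -/
def shiftedCourantNijenhuis (φ : Module.End A (GenTangent A L)) (x y : GenTangent A L) :
    GenTangent A L :=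
  courantNijenhuis φ (φ x) y + courantNijenhuis φ x (φ y)

/-- Weak generalized Nijenhuis operators: the shifted Courant-Nijenhuis torsion vanishes. -/
def IsWeakNijenhuis (φ : Module.End A (GenTangent A L)) : Prop :=
  ∀ x y, shiftedCourantNijenhuis φ x y = 0

/-- `Φ` is the lift of `φ` to the operators on forms: `Φ` is even, commutes with multiplication by
functions, satisfies `[Φ, x] = φ(x)` for all sections `x` of the generalized tangent bundle, and
maps the constant function `1` to a `2`-form. -/
structure IsLift (φ : Module.End A (GenTangent A L)) (Φ : Operator A L) : Prop where
  even : IsEven Φ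
  comm_mulFunction : ∀ f : A, gradedCommutator Φ (mulFunction f) = 0
  comm_clifford : ∀ x : GenTangent A L, gradedCommutator Φ (clifford x) = clifford (φ x)
  map_one : ∀ k : ℕ, k ≠ 2 → (Φ constOne).component k = 0

/-- The operator `P(ad_Φ)(d)`; for `Φ` the lift of `φ` and `P` the minimal polynomial of `φ` this is
the minimal operator of `φ`. -/
def minimalOperator (Φ : Operator A L) (P : Polynomial ℝ) : Operator A L :=
  Polynomial.aeval (gradedAd Φ) P (deRham A L)

/-- Minimality of a generalized polynomial structure `φ` with minimal polynomial `P`: the derived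
bracket of the minimal operator (formed with the lift of `φ`) vanishes on sections of the
generalized tangent bundle. -/
def IsMinimal (φ : Module.End A (GenTangent A L)) (P : Polynomial ℝ) : Prop :=
  ∃ Φ : Operator A L, IsLift φ Φ ∧
    ∀ x y, derivedBracket (minimalOperator Φ P) (clifford x) (clifford y) = 0

end Operators

section Structures

variable {n : ℕ} {M : Type*} [TopologicalSpace M]
  [ChartedSpace (EuclideanSpace ℝ (Fin n)) M] [IsManifold (𝓡 n) ∞ M]

variable (n M) in
/-- The smooth sections of the generalized tangent bundle of the `n`-manifold `M`. -/
abbrev GenTangentSection : Type _ := GenTangent (SmoothFunction n M) (SmoothVectorField n M)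

variable (n) in
/-- The ideal of smooth functions that vanish at `p`. -/
def vanishingIdeal (p : M) : Ideal (SmoothFunction n M) where
  carrier := {f | f p = 0}
  add_mem' {f g} hf hg := by
    change f p + g p = 0
    rw [show f p = 0 from hf, show g p = 0 from hg, add_zero]
  zero_mem' := rfl
  smul_mem' c f hf := by
    change c p * f p = 0
    rw [show f p = 0 from hf, mul_zero]

/-- The fibre at `p` of the generalized tangent bundle: sections modulo the sections with
coefficients that vanish at `p`. -/
abbrev Fibre (n : ℕ) {M : Type*} [TopologicalSpace M] [ChartedSpace (EuclideanSpace ℝ (Fin n)) M]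
    [IsManifold (𝓡 n) ∞ M] (p : M) : Type _ :=
  GenTangentSection n M ⧸
    (vanishingIdeal n p • ⊤ : Submodule (SmoothFunction n M) (GenTangentSection n M))

/-- The endomorphism of the fibre at `p` induced by a bundle endomorphism. -/
def fibreMap (φ : Module.End (SmoothFunction n M) (GenTangentSection n M)) (p : M) :
    Module.End ℝ (Fibre n p) :=
  (Submodule.mapQ _ _ φ (Submodule.smul_top_le_comap_smul_top _ φ)).restrictScalars ℝ

/-- `φ` is a generalized polynomial structure with minimal polynomial `P`: it is skew-symmetric and
at every point its fibre endomorphism has minimal polynomial `P`. -/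
structure IsGenPolynomialStructure
    (φ : Module.End (SmoothFunction n M) (GenTangentSection n M)) (P : Polynomial ℝ) : Prop where
  skew : IsSkew φ
  monic : P.Monic
  degree_pos : 0 < P.natDegree
  minpoly_eq : ∀ p : M, minpoly ℝ (fibreMap φ p) = P

/-- A bundle endomorphism is semisimple if all its fibre endomorphisms are. -/
def IsFibrewiseSemisimple (φ : Module.End (SmoothFunction n M) (GenTangentSection n M)) : Prop :=
  ∀ p : M, (fibreMap φ p).IsSemisimple

end Structures

end GeneralizedGeometry

end

/-!
Sections of the generalized tangent bundle act on forms by Clifford operators, and the Dorfman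
bracket is the derived bracket `[[x, d], y]` of the de Rham differential
(`clifford_deRham_clifford`).  For a lift `Φ` of `φ` the adjoint action of `Φ` is a derivation of
the graded commutator that restricts to `φ` on sections.  Hence the derived bracket of
`P(ad_Φ)(d)` is `P(a - b - c)` applied to the Dorfman bracket, where `a`, `b`, `c` are the commuting
operators on bilinear maps `B` of sections that send `B(x, y)` to `φ B(x, y)`, `B(φ x, y)`,
`B(x, φ y)` (`hasDerivedBracket_minimalOperator`).

In these terms the shifted Courant-Nijenhuis torsion is `(b + c)(a - b)(a - c)` applied to the
Dorfman bracket.  The fibrewise minimal polynomial `P` satisfies `P(φ) = 0` globally, so `P(a) = 0`;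
by skewness and the nondegeneracy of the inner product `P(-φ) = 0`, so `P(-b) = P(-c) = 0`.
Modulo `b + c`, `a - b` and `a - c` the operator `a - b - c` is `a`, `-c` and `-b`, so each of the
three factors divides `P(a - b - c)`, and their product divides its cube.  Semisimplicity makes `P`
squarefree, so `P(a - b - c)` is itself semisimple and is a multiple of its cube.  Therefore the
vanishing of the shifted torsion gives `P(a - b - c) = 0` on the Dorfman bracket
(`polynomialBilinearAd_eq_zero`).

The lift exists because `φ` is locally given by a finite sum of products of Clifford operators,
written down in a frame and its dual frame (`exists_lift_of_frame`, `exists_frame`); the local lifts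
are glued with a partition of unity (`exists_isLift`).
-/

noncomputable section

namespace GeneralizedGeometry

set_option linter.unusedSectionVars false

/-! ### Cartan calculus of operators on forms -/

section CartanCalculus
variable {A L : Type*} [CommRing A] [Algebra ℝ A] [LieRing L] [LieAlgebra ℝ L] [Module A L]
  [LieRingModule L A] [LieRinehartRing A L] [LieRinehartAlgebra ℝ A L]

@[simp] theorem Forms.component_zero (k : ℕ) : (0 : Forms A L).component k = 0 := rfl

@[simp] theorem Forms.component_neg (θ : Forms A L) (k : ℕ) :
    (-θ).component k = -θ.component k := rfl

@[simp] theorem Forms.component_sub (θ η : Forms A L) (k : ℕ) :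
    (θ - η).component k = θ.component k - η.component k := rfl

@[simp] theorem Forms.component_sum {ι : Type*} (s : Finset ι) (θ : ι → Forms A L) (k : ℕ) :
    (∑ i ∈ s, θ i).component k = ∑ i ∈ s, (θ i).component k :=
  Finset.sum_apply k s θ

theorem DForm.sum_apply {ι : Type*} (s : Finset ι) {k : ℕ} (θ : ι → DForm A L k) (v : Fin k → L) :
    (∑ i ∈ s, θ i) v = ∑ i ∈ s, θ i v := by
  classical
  induction s using Finset.induction_on with
  | empty => simp
  | insert i s hi ih => simp [Finset.sum_insert hi, ih]

theorem mulFunction_component (f : A) (θ : Forms A L) (k : ℕ) :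
    (mulFunction f θ).component k = f • θ.component k := rfl

theorem contraction_component (X : L) (θ : Forms A L) (k : ℕ) (v : Fin k → L) :
    (contraction X θ).component k v = θ.component (k + 1) (Fin.cons X v) := rfl

theorem wedge_component_zero (α : Module.Dual A L) (θ : Forms A L) :
    (wedge α θ).component 0 = 0 := rfl

theorem wedge_component_succ (α : Module.Dual A L) (θ : Forms A L) (k : ℕ) (v : Fin (k + 1) → L) :
    (wedge α θ).component (k + 1) v =
      ∑ i : Fin (k + 1), (-1) ^ (i : ℕ) • (α (v i) * θ.component k (i.removeNth v)) := by
  change AlternatingMap.alternatizeUncurryFin (LinearMap.smulRight α (θ.component k)) v = _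
  rw [AlternatingMap.alternatizeUncurryFin_apply]
  rfl

theorem deRham_component_zero (θ : Forms A L) : (deRham A L θ).component 0 = 0 := rfl

theorem deRham_component_succ (θ : Forms A L) (k : ℕ) :
    (deRham A L θ).component (k + 1) = DForm.extDeriv (θ.component k) := rfl

theorem parity_component (θ : Forms A L) (k : ℕ) :
    (parity θ).component k = (-1 : ℝ) ^ k • θ.component k := rfl

/-- An operator whose values have no component of degree `0` and which commutes with contractions
up to a scalar vanishes: the contractions of a form of positive degree determine the form, so one
can argue by induction on the degree of the values. -/
theorem operator_eq_zero_of_contraction {U : Operator A L} (c : ℝ)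
    (h0 : ∀ θ, (U θ).component 0 = 0)
    (hc : ∀ Z : L, contraction Z * U = c • (U * contraction Z)) : U = 0 := by
  have key : ∀ k θ, (U θ).component k = 0 := by
    intro k
    induction k with
    | zero => exact h0
    | succ k ih =>
      intro θ
      ext v
      have h := congrArg (fun B : Operator A L => (B θ).component k (Fin.tail v)) (hc (v 0))
      simp only [Module.End.mul_apply, LinearMap.smul_apply, Forms.component_smul, ih,
        contraction_component, Fin.cons_self_tail,
        AlternatingMap.zero_apply, smul_zero] at h
      exact h
  ext1 θ
  exact Forms.ext fun k => key k θ

theorem mulFunction_mul (f g : A) :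
    (mulFunction (f * g) : Operator A L) = mulFunction f * mulFunction g := by
  ext1 θ
  refine Forms.ext fun k => ?_
  simp [mulFunction_component, mul_smul]

theorem mulFunction_add (f g : A) :
    (mulFunction (f + g) : Operator A L) = mulFunction f + mulFunction g := by
  ext1 θ
  refine Forms.ext fun k => ?_
  simp [mulFunction_component, add_smul]

theorem contraction_add (X Y : L) :
    (contraction (X + Y) : Operator A L) = contraction X + contraction Y := by
  ext1 θ
  refine Forms.ext fun k => ?_
  ext v
  simpa [contraction_component] using (θ.component (k + 1)).map_update_add (Fin.cons 0 v) 0 X Y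

theorem contraction_smul (f : A) (X : L) :
    (contraction (f • X) : Operator A L) = mulFunction f * contraction X := by
  ext1 θ
  refine Forms.ext fun k => ?_
  ext v
  simpa [contraction_component, mulFunction_component] using
    (θ.component (k + 1)).map_update_smul (Fin.cons 0 v) 0 f X

theorem wedge_add (α β : Module.Dual A L) : wedge (α + β) = wedge α + wedge β := by
  ext1 θ
  refine Forms.ext fun k => ?_
  cases k with
  | zero => simp [wedge_component_zero]
  | succ k =>
    ext v
    simp [wedge_component_succ, add_mul, Finset.sum_add_distrib]

theorem wedge_smul (f : A) (α : Module.Dual A L) : wedge (f • α) = mulFunction f * wedge α := by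
  ext1 θ
  refine Forms.ext fun k => ?_
  cases k with
  | zero => simp [wedge_component_zero, mulFunction_component]
  | succ k =>
    ext v
    simp [wedge_component_succ, mulFunction_component, mul_assoc, mul_left_comm f, Finset.mul_sum]

theorem clifford_add (x y : GenTangent A L) : clifford (x + y) = clifford x + clifford y := by
  simp only [clifford, Prod.fst_add, Prod.snd_add, contraction_add, wedge_add]
  abel

theorem clifford_smul (f : A) (x : GenTangent A L) :
    clifford (f • x) = mulFunction f * clifford x := by
  simp only [clifford, Prod.smul_fst, Prod.smul_snd, contraction_smul, wedge_smul, mul_add]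

theorem mulFunction_algebraMap (c : ℝ) :
    (mulFunction (algebraMap ℝ A c) : Operator A L) = c • 1 := by
  ext1 θ
  refine Forms.ext fun k => ?_
  ext v
  simp [mulFunction_component, Algebra.smul_def]

variable (A L) in
/-- The action of sections of the generalized tangent bundle on forms, as a linear map. -/
def cliffordLinear : GenTangent A L →ₗ[ℝ] Operator A L where
  toFun := clifford
  map_add' := clifford_add
  map_smul' c x := by
    rw [← algebraMap_smul A c x, clifford_smul, mulFunction_algebraMap]
    simp

theorem contraction_mul_mulFunction (X : L) (f : A) :
    (contraction X * mulFunction f : Operator A L) = mulFunction f * contraction X := rfl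

theorem wedge_mul_mulFunction (α : Module.Dual A L) (f : A) :
    (wedge α * mulFunction f : Operator A L) = mulFunction f * wedge α := by
  ext1 θ
  refine Forms.ext fun k => ?_
  cases k with
  | zero => simp [wedge_component_zero, mulFunction_component]
  | succ k =>
    ext v
    simp [wedge_component_succ, mulFunction_component, Finset.mul_sum, mul_left_comm]

theorem clifford_mul_mulFunction (x : GenTangent A L) (f : A) :
    clifford x * mulFunction f = mulFunction f * clifford x := by
  simp only [clifford, add_mul, mul_add, contraction_mul_mulFunction, wedge_mul_mulFunction]

theorem contraction_anticomm (X Y : L) :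
    (contraction X * contraction Y + contraction Y * contraction X : Operator A L) = 0 := by
  ext1 θ
  refine Forms.ext fun k => ?_
  ext v
  have h := (θ.component (k + 2)).map_swap (Fin.cons X (Fin.cons Y v)) (i := 0) (j := 1) (by simp)
  have e : (Fin.cons X (Fin.cons Y v) : Fin (k + 2) → L) ∘ Equiv.swap 0 1 =
      Fin.cons Y (Fin.cons X v) := by
    ext i
    refine Fin.cases ?_ (fun i => Fin.cases ?_ (fun i => ?_) i) i
    · simp
    · simp
    · rw [Function.comp_apply, Equiv.swap_apply_of_ne_of_ne]
      · rfl
      · exact Fin.succ_ne_zero _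
      · exact (Fin.succ_injective _).ne (Fin.succ_ne_zero _)
  rw [e] at h
  simp [contraction_component, h]

theorem contraction_wedge (X : L) (α : Module.Dual A L) :
    contraction X * wedge α + wedge α * contraction X = mulFunction (α X) := by
  ext1 θ
  refine Forms.ext fun k => ?_
  ext v
  simp only [LinearMap.add_apply, Module.End.mul_apply, Forms.component_add,
    AlternatingMap.add_apply, contraction_component, wedge_component_succ, mulFunction_component,
    AlternatingMap.smul_apply]
  rw [Fin.sum_univ_succ]
  simp only [DForm.removeNth_zero_cons, Fin.cons_zero, Fin.val_zero, pow_zero, one_smul,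
    Fin.cons_succ, Fin.val_succ, smul_eq_mul]
  cases k with
  | zero => simp [wedge_component_zero]
  | succ k =>
    simp only [DForm.removeNth_succ_cons, wedge_component_succ, contraction_component, pow_succ',
      mul_smul, neg_one_smul, Finset.sum_neg_distrib]
    abel

theorem wedge_anticomm (α β : Module.Dual A L) :
    wedge α * wedge β + wedge β * wedge α = 0 := by
  refine operator_eq_zero_of_contraction 1 (fun θ => ?_) fun Z => ?_
  · simp [wedge_component_zero]
  · have h1 := eq_sub_of_add_eq (contraction_wedge Z α)
    have h2 := eq_sub_of_add_eq (contraction_wedge Z β)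
    rw [one_smul, mul_add, ← mul_assoc, ← mul_assoc, h1, h2, sub_mul, sub_mul, mul_assoc, mul_assoc,
      h1, h2, mul_sub, mul_sub, wedge_mul_mulFunction, wedge_mul_mulFunction]
    noncomm_ring

/-- The Clifford relation `x y + y x = 2 ⟨x, y⟩`. -/
theorem clifford_anticomm (x y : GenTangent A L) :
    clifford x * clifford y + clifford y * clifford x = mulFunction (x.2 y.1 + y.2 x.1) := by
  have h1 := contraction_anticomm (A := A) x.1 y.1
  have h2 := contraction_wedge x.1 y.2
  have h3 := contraction_wedge y.1 x.2
  have h4 := wedge_anticomm x.2 y.2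
  rw [mulFunction_add, ← h2, ← h3, ← sub_eq_zero, ← h1, ← add_zero (contraction x.1 * _ + _), ← h4]
  simp only [clifford]
  noncomm_ring

variable (A) in
/-- The Lie derivative of forms along a vector field, through Cartan's formula. -/
def lieOperator (X : L) : Operator A L :=
  contraction X * deRham A L + deRham A L * contraction X

theorem lieOperator_apply (X : L) (θ : Forms A L) (k : ℕ) (v : Fin k → L) :
    (lieOperator A X θ).component k v =
      ⁅X, θ.component k v⁆ - ∑ j, θ.component k (Function.update v j ⁅X, v j⁆) := by
  simp only [lieOperator, LinearMap.add_apply, Module.End.mul_apply, Forms.component_add,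
    AlternatingMap.add_apply, contraction_component, deRham_component_succ]
  cases k with
  | zero =>
    obtain ⟨f, hf⟩ : ∃ f, θ.component 0 = AlternatingMap.constOfIsEmpty A L (Fin 0) f :=
      ⟨θ.component 0 v, by ext w; simp [Subsingleton.elim w v]⟩
    simp [deRham_component_zero, hf, DForm.extDeriv_zero]
  | succ k =>
    rw [DForm.cartan]
    simp only [deRham_component_succ]
    exact sub_add_cancel _ _

theorem lieOperator_contraction (X Y : L) :
    lieOperator A X * contraction Y - contraction Y * lieOperator A X =
      contraction ⁅X, Y⁆ := by
  ext1 θ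
  refine Forms.ext fun k => ?_
  ext v
  simp only [LinearMap.sub_apply, Module.End.mul_apply, Forms.component_sub,
    AlternatingMap.sub_apply, lieOperator_apply, contraction_component]
  rw [Fin.sum_univ_succ]
  simp only [Fin.cons_zero, Fin.cons_succ, Fin.update_cons_zero, ← Fin.cons_update]
  abel

theorem lieOperator_mulFunction (X : L) (f : A) :
    lieOperator A X * mulFunction f - mulFunction f * lieOperator A X = mulFunction ⁅X, f⁆ := by
  ext1 θ
  refine Forms.ext fun k => ?_
  ext v
  simp only [LinearMap.sub_apply, Module.End.mul_apply, Forms.component_sub,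
    AlternatingMap.sub_apply, lieOperator_apply, mulFunction_component, AlternatingMap.smul_apply,
    smul_eq_mul, LieRinehartRing.leibniz_mul_right, mul_sub, Finset.mul_sum]
  abel

theorem lieOperator_wedge (X : L) (α : Module.Dual A L) :
    lieOperator A X * wedge α - wedge α * lieOperator A X = wedge (lieDerivative X α) := by
  rw [← sub_eq_zero]
  refine operator_eq_zero_of_contraction (-1) (fun θ => ?_) fun Z => ?_
  · ext v
    simp [wedge_component_zero, lieOperator_apply]
  · have h1 := contraction_wedge Z α
    have h2 := contraction_wedge Z (lieDerivative X α)
    have h3 := contraction_wedge ⁅X, Z⁆ α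
    have h4 := lieOperator_contraction (A := A) X Z
    have h5 := lieOperator_mulFunction X (α Z)
    have h6 : (mulFunction (lieDerivative X α Z) : Operator A L) =
        mulFunction ⁅X, α Z⁆ - mulFunction (α ⁅X, Z⁆) := by
      rw [eq_sub_iff_add_eq, ← mulFunction_add]
      congr 1
      exact sub_add_cancel _ _
    rw [h6] at h2
    rw [← h1] at h5
    rw [← h4] at h3
    rw [← h3, ← h5] at h2
    rw [neg_one_smul, ← sub_eq_zero]
    rw [← sub_eq_zero] at h2
    rw [← neg_eq_zero, ← h2]
    noncomm_ring

/-- The differential `df` of a function, as a `1`-form. -/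
def differential (f : A) : Module.Dual A L where
  toFun X := ⁅X, f⁆
  map_add' X Y := add_lie X Y f
  map_smul' g X := LieRinehartRing.lie_smul_eq_mul g f X

@[simp] theorem differential_apply (f : A) (X : L) : differential f X = ⁅X, f⁆ := rfl

theorem deRham_mulFunction (f : A) :
    deRham A L * mulFunction f - mulFunction f * deRham A L = wedge (differential f) := by
  rw [← sub_eq_zero]
  refine operator_eq_zero_of_contraction (-1) (fun θ => ?_) fun Z => ?_
  · simp [wedge_component_zero, deRham_component_zero, mulFunction_component]
  · have h1 := contraction_wedge Z (differential f)
    have h2 := lieOperator_mulFunction Z f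
    have h3 := contraction_mul_mulFunction Z f
    rw [differential_apply, ← h2, lieOperator, ← sub_eq_zero] at h1
    rw [neg_one_smul, ← sub_eq_zero, ← neg_eq_zero, ← h1]
    simp only [mul_sub, sub_mul, mul_add, add_mul, ← mul_assoc, h3]
    simp only [mul_assoc, h3]
    noncomm_ring

/-- The graded commutator of `α` and `d` is exterior multiplication by `dα`; its commutator with the
contraction by `Y` follows from the Jacobi identity and `ι_Y dα = L_Y α - d(α(Y))`. -/
theorem wedge_deRham_contraction (α : Module.Dual A L) (Y : L) :
    (wedge α * deRham A L + deRham A L * wedge α) * contraction Y -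
      contraction Y * (wedge α * deRham A L + deRham A L * wedge α) =
      -wedge (contractDeriv Y α) := by
  have h1 := contraction_wedge Y α
  have h2 := deRham_mulFunction (L := L) (α Y)
  have h3 := lieOperator_wedge Y α
  have h4 : wedge (contractDeriv Y α) + wedge (differential (α Y)) = wedge (lieDerivative Y α) := by
    rw [← wedge_add]
    congr 1
    ext Z
    change ⁅Y, α Z⁆ - ⁅Z, α Y⁆ - α ⁅Y, Z⁆ + ⁅Z, α Y⁆ = ⁅Y, α Z⁆ - α ⁅Y, Z⁆
    abel
  rw [← h3, ← h2, ← h1, lieOperator] at h4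
  rw [eq_sub_of_add_eq h4]
  noncomm_ring

theorem wedge_deRham_mulFunction (α : Module.Dual A L) (f : A) :
    (wedge α * deRham A L + deRham A L * wedge α) * mulFunction f =
      mulFunction f * (wedge α * deRham A L + deRham A L * wedge α) := by
  have h1 := deRham_mulFunction (L := L) f
  have h2 := wedge_anticomm α (differential f)
  have h3 := wedge_mul_mulFunction α f
  rw [← h1] at h2
  rw [← sub_eq_zero, ← h2]
  simp only [mul_sub, sub_mul, mul_add, add_mul, ← mul_assoc, h3]
  simp only [mul_assoc, h3]
  noncomm_ring

/-- Exterior multiplication by the `2`-form `dα` commutes with exterior multiplication by `β`. -/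
theorem wedge_deRham_wedge (α β : Module.Dual A L) :
    (wedge α * deRham A L + deRham A L * wedge α) * wedge β -
      wedge β * (wedge α * deRham A L + deRham A L * wedge α) = 0 := by
  refine operator_eq_zero_of_contraction (-1) (fun θ => ?_) fun Z => ?_
  · simp [wedge_component_zero, deRham_component_zero]
  · have h1 := contraction_wedge Z β
    have h2 := wedge_deRham_contraction α Z
    have h3 := wedge_deRham_mulFunction α (β Z)
    have h4 := wedge_anticomm (contractDeriv Z α) β
    set D := wedge α * deRham A L + deRham A L * wedge α
    rw [← h1] at h3
    rw [← neg_eq_iff_eq_neg] at h2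
    rw [← h2] at h4
    rw [neg_one_smul, ← sub_eq_zero]
    rw [← sub_eq_zero] at h3
    have : (D * (contraction Z * wedge β + wedge β * contraction Z) -
      (contraction Z * wedge β + wedge β * contraction Z) * D) +
      (-(D * contraction Z - contraction Z * D) * wedge β +
       wedge β * -(D * contraction Z - contraction Z * D)) = 0 := by
      rw [h3, h4, add_zero]
    rw [← this]
    noncomm_ring

/-- The Dorfman bracket is the derived bracket of the de Rham differential. -/
theorem clifford_deRham_clifford (x y : GenTangent A L) :
    (clifford x * deRham A L + deRham A L * clifford x) * clifford y -
      clifford y * (clifford x * deRham A L + deRham A L * clifford x) =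
      clifford (dorfman x y) := by
  have h1 := lieOperator_contraction (A := A) x.1 y.1
  have h2 := lieOperator_wedge x.1 y.2
  have h3 := wedge_deRham_contraction x.2 y.1
  have h4 := wedge_deRham_wedge x.2 y.2
  have h5 : wedge (lieDerivative x.1 y.2 - contractDeriv y.1 x.2) +
      wedge (contractDeriv y.1 x.2) = wedge (lieDerivative x.1 y.2) := by
    rw [← wedge_add, sub_add_cancel]
  simp only [clifford, dorfman]
  rw [eq_sub_of_add_eq h5, ← h1, ← h2, sub_eq_add_neg _ (wedge _), ← h3, ← sub_eq_zero, ← h4,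
    lieOperator]
  noncomm_ring

end CartanCalculus

/-! ### Polynomials in commuting semisimple operators -/

section SemisimpleAlgebra
open Polynomial

/-- Multiplication by an element that is annihilated by a squarefree polynomial is semisimple. -/
theorem isSemisimple_lmul {S : Type*} [CommRing S] [Algebra ℝ S] {P : ℝ[X]} (hP : Squarefree P)
    {a : S} (ha : aeval a P = 0) : (Algebra.lmul ℝ S a).IsSemisimple :=
  Module.End.isSemisimple_of_squarefree_aeval_eq_zero hP <| by
    rw [aeval_algHom_apply, ha, map_zero]

theorem squarefree_minpoly_of_isSemisimple {V : Type*} [AddCommGroup V] [Module ℝ V]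
    {f : Module.End ℝ V} (hf : f.IsSemisimple) (h0 : minpoly ℝ f ≠ 0) :
    Squarefree (minpoly ℝ f) :=
  IsRadical.squarefree h0 <| by
    rw [isRadical_iff_span_singleton, span_minpoly_eq_annihilator]
    exact hf.annihilator_isRadical

/-- A semisimple element `r` of a finite-dimensional algebra is divisible by its square, since `X` is
a combination of `X ^ 2` and the squarefree minimal polynomial of `r`. -/
theorem sq_dvd_self_of_isSemisimple_lmul {S : Type*} [CommRing S] [Algebra ℝ S] [Module.Finite ℝ S]
    {r : S} (hr : (Algebra.lmul ℝ S r).IsSemisimple) : r ^ 2 ∣ r := by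
  set Q := minpoly ℝ (Algebra.lmul ℝ S r) with hQdef
  have hQ : Squarefree Q := hr.minpoly_squarefree
  have hQr : aeval r Q = 0 := by
    have h : Algebra.lmul ℝ S (aeval r Q) = 0 := by
      rw [← aeval_algHom_apply]
      exact minpoly.aeval ℝ _
    simpa using congrArg (fun T : Module.End ℝ S => T 1) h
  by_cases hX : X ∣ Q
  · obtain ⟨Q', hQ'⟩ := hX
    have hcop : IsCoprime X Q' := by
      refine irreducible_X.coprime_iff_not_dvd.2 fun ⟨Q'', hQ''⟩ => ?_
      exact irreducible_X.not_isUnit (hQ X ⟨Q'', by rw [hQ', hQ'', mul_assoc]⟩)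
    obtain ⟨u, v, huv⟩ := hcop
    have h1 : u * X ^ 2 + v * Q = X := by
      rw [hQ']
      linear_combination X * huv
    have h2 := congrArg (aeval r) h1
    simp only [map_add, map_mul, map_pow, aeval_X, hQr, mul_zero, add_zero] at h2
    exact ⟨aeval r u, by rw [mul_comm, h2]⟩
  · obtain ⟨u, v, huv⟩ := irreducible_X.coprime_iff_not_dvd.2 hX
    have h2 := congrArg (aeval r) huv
    simp only [map_add, map_mul, aeval_X, hQr, mul_zero, add_zero, map_one] at h2
    exact ⟨aeval r u, by linear_combination (-r) * h2⟩

theorem dvd_of_aeval_eq_zero {S : Type*} [CommRing S] [Algebra ℝ S] (P : ℝ[X]) {r s : S}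
    (hs : aeval s P = 0) : r - s ∣ aeval r P := by
  have h := sub_dvd_eval_sub r s (P.map (algebraMap ℝ S))
  rwa [eval_map_algebraMap, eval_map_algebraMap, hs, sub_zero] at h

/-- Each of the factors `b + c`, `a - b`, `a - c` divides `P (a - b - c)`, as modulo these factors
`a - b - c` is `a`, `-c`, `-b`.  So their product divides the cube of `P (a - b - c)`, which by
semisimplicity generates the same ideal as `P (a - b - c)`. -/
theorem dvd_aeval_sub_sub_of_finite {S : Type*} [CommRing S] [Algebra ℝ S] [Module.Finite ℝ S]
    {P : ℝ[X]} (hP : Squarefree P) {a b c : S} (ha : aeval a P = 0) (hb : aeval (-b) P = 0)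
    (hc : aeval (-c) P = 0) : (b + c) * ((a - b) * (a - c)) ∣ aeval (a - b - c) P := by
  set r := aeval (a - b - c) P with hr
  have hss : (Algebra.lmul ℝ S r).IsSemisimple := by
    rw [hr, ← aeval_algHom_apply]
    refine Module.End.IsSemisimple.aeval ?_ P
    rw [sub_eq_add_neg, sub_eq_add_neg, map_add, map_add]
    exact ((isSemisimple_lmul hP ha).add_of_commute ((Commute.all a (-b)).map _)
      (isSemisimple_lmul hP hb)).add_of_commute
        ((((Commute.all a (-c)).map _).add_left ((Commute.all (-b) (-c)).map _)))
        (isSemisimple_lmul hP hc)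
  obtain ⟨t, ht⟩ := sq_dvd_self_of_isSemisimple_lmul hss
  have h1 : b + c ∣ r := by
    have := dvd_of_aeval_eq_zero P (r := a - b - c) ha
    rwa [show a - b - c - a = -(b + c) by ring, neg_dvd] at this
  have h2 : a - b ∣ r := by
    have := dvd_of_aeval_eq_zero P (r := a - b - c) hc
    rwa [show a - b - c - -c = a - b by ring] at this
  have h3 : a - c ∣ r := by
    have := dvd_of_aeval_eq_zero P (r := a - b - c) hb
    rwa [show a - b - c - -b = a - c by ring] at this
  have h4 : r = r * (r * r) * t ^ 2 := by linear_combination (1 + r * t) * ht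
  rw [h4]
  exact Dvd.dvd.mul_right (mul_dvd_mul h1 (mul_dvd_mul h2 h3)) _

/-- If commuting linear maps `a`, `-b`, `-c` are annihilated by a squarefree polynomial `P`, then
`P (a - b - c)` annihilates every vector that is annihilated by `(b + c) (a - b) (a - c)`. -/
theorem aeval_sub_sub_apply_eq_zero {V : Type*} [AddCommGroup V] [Module ℝ V] {P : ℝ[X]}
    (hP : Squarefree P) {a b c : Module.End ℝ V} (hab : Commute a b) (hac : Commute a c)
    (hbc : Commute b c) (ha : aeval a P = 0) (hb : aeval (-b) P = 0) (hc : aeval (-c) P = 0)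
    {v : V} (hv : ((b + c) * ((a - b) * (a - c))) v = 0) : aeval (a - b - c) P v = 0 := by
  set s : Set (Module.End ℝ V) := {a, b, c} with hs
  have hcomm : ∀ x ∈ s, ∀ y ∈ s, x * y = y * x := by
    rintro x (rfl | rfl | rfl) y (rfl | rfl | rfl)
    exacts [rfl, hab, hac, hab.symm, rfl, hbc, hac.symm, hbc.symm, rfl]
  have : IsMulCommutative (Algebra.adjoin ℝ s) := Algebra.isMulCommutative_adjoin ℝ hcomm
  let : CommRing (Algebra.adjoin ℝ s) :=
    { (inferInstance : Ring (Algebra.adjoin ℝ s)) with mul_comm := mul_comm' }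
  have hmem : ∀ x ∈ s, x ∈ Algebra.adjoin ℝ s := fun x hx => Algebra.subset_adjoin hx
  let a' : Algebra.adjoin ℝ s := ⟨a, hmem a (by simp [hs])⟩
  let b' : Algebra.adjoin ℝ s := ⟨b, hmem b (by simp [hs])⟩
  let c' : Algebra.adjoin ℝ s := ⟨c, hmem c (by simp [hs])⟩
  have hval (x : Algebra.adjoin ℝ s) : ((aeval x P : Algebra.adjoin ℝ s) : Module.End ℝ V) =
      aeval (x : Module.End ℝ V) P := (aeval_algHom_apply (Algebra.adjoin ℝ s).val x P).symm
  have ha' : aeval a' P = 0 := Subtype.ext <| (hval a').trans ha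
  have hb' : aeval (-b') P = 0 := Subtype.ext <| (hval (-b')).trans hb
  have hc' : aeval (-c') P = 0 := Subtype.ext <| (hval (-c')).trans hc
  have hfin : Module.Finite ℝ (Algebra.adjoin ℝ s) := by
    have hint {x : Algebra.adjoin ℝ s} (hx : aeval x P = 0) : IsIntegral ℝ x :=
      isAlgebraic_iff_isIntegral.1 ⟨P, hP.ne_zero, hx⟩
    have hsub : (((↑) : Algebra.adjoin ℝ s → Module.End ℝ V) ⁻¹' s) = {a', b', c'} := by
      ext x
      simp [hs, a', b', c', Subtype.ext_iff]
    have hfg := fg_adjoin_of_finite (R := ℝ) (s := ({a', b', c'} : Set (Algebra.adjoin ℝ s)))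
      (Set.toFinite _) (by
        rintro x (rfl | rfl | rfl)
        · exact hint ha'
        · simpa using (hint hb').neg
        · simpa using (hint hc').neg)
    rw [← hsub, Algebra.adjoin_adjoin_coe_preimage] at hfg
    exact ⟨hfg⟩
  obtain ⟨t, ht⟩ := dvd_aeval_sub_sub_of_finite hP ha' hb' hc'
  have h := (hval (a' - b' - c')).symm.trans (congrArg Subtype.val (ht.trans (mul_comm _ _)))
  change aeval (a - b - c) P = (t : Module.End ℝ V) * ((b + c) * ((a - b) * (a - c))) at h
  rw [h, Module.End.mul_apply, hv, map_zero]

end SemisimpleAlgebra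

/-! ### Operators on bilinear maps -/

section BilinearMaps
open Polynomial


theorem aeval_apply_of_intertwine {V W : Type*} [AddCommGroup V] [Module ℝ V] [AddCommGroup W]
    [Module ℝ W] {F : Module.End ℝ V} {G : Module.End ℝ W} (f : V →ₗ[ℝ] W)
    (h : ∀ v, f (F v) = G (f v)) (P : ℝ[X]) (v : V) : aeval G P (f v) = f (aeval F P v) := by
  induction P using Polynomial.induction_on generalizing v with
  | C c => simp [Module.algebraMap_end_apply]
  | add P Q hP hQ => simp [hP, hQ]
  | monomial k c ih =>
    rw [pow_succ, ← mul_assoc, map_mul _ _ X, map_mul _ _ X, aeval_X, aeval_X,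
      Module.End.mul_apply, Module.End.mul_apply, ← ih, h]

theorem aeval_apply_of_adjoint {V W : Type*} [AddCommGroup V] [Module ℝ V] [AddCommGroup W]
    [Module ℝ W] {F G : Module.End ℝ V} (B : V →ₗ[ℝ] V →ₗ[ℝ] W)
    (h : ∀ v w, B (F v) w = B v (G w)) (P : ℝ[X]) (v w : V) :
    B (aeval F P v) w = B v (aeval G P w) := by
  induction P using Polynomial.induction_on generalizing v w with
  | C c => simp [Module.algebraMap_end_apply]
  | add P Q hP hQ => simp [hP, hQ]
  | monomial k c ih =>
    rw [pow_succ, ← mul_assoc, map_mul _ _ X, aeval_X, Module.End.mul_apply, ih, h, mul_comm _ X,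
      map_mul _ X, aeval_X, Module.End.mul_apply]

variable {T : Type*} [AddCommGroup T] [Module ℝ T]

/-- Composition of bilinear maps `T × T → T` with a linear map after them. -/
def postComp (f : Module.End ℝ T) : Module.End ℝ (T →ₗ[ℝ] T →ₗ[ℝ] T) where
  toFun B := B.compr₂ f
  map_add' B C := by ext; simp
  map_smul' r B := by ext; simp

/-- Composition of bilinear maps `T × T → T` with a linear map in the first argument. -/
def preCompLeft (f : Module.End ℝ T) : Module.End ℝ (T →ₗ[ℝ] T →ₗ[ℝ] T) where
  toFun B := B.comp f
  map_add' B C := by ext; simp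
  map_smul' r B := by ext; simp

/-- Composition of bilinear maps `T × T → T` with a linear map in the second argument. -/
def preCompRight (f : Module.End ℝ T) : Module.End ℝ (T →ₗ[ℝ] T →ₗ[ℝ] T) where
  toFun B := B.compl₂ f
  map_add' B C := by ext; simp
  map_smul' r B := by ext; simp

@[simp] theorem postComp_apply (f : Module.End ℝ T) (B : T →ₗ[ℝ] T →ₗ[ℝ] T) (x y : T) :
    postComp f B x y = f (B x y) := rfl

@[simp] theorem preCompLeft_apply (f : Module.End ℝ T) (B : T →ₗ[ℝ] T →ₗ[ℝ] T) (x y : T) :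
    preCompLeft f B x y = B (f x) y := rfl

@[simp] theorem preCompRight_apply (f : Module.End ℝ T) (B : T →ₗ[ℝ] T →ₗ[ℝ] T) (x y : T) :
    preCompRight f B x y = B x (f y) := rfl

theorem aeval_postComp (f : Module.End ℝ T) (P : ℝ[X]) :
    aeval (postComp f) P = postComp (aeval f P) := by
  ext B x y
  induction P using Polynomial.induction_on' with
  | add p q hp hq => simp_all
  | monomial k r =>
    have h : ∀ (k : ℕ) (B : T →ₗ[ℝ] T →ₗ[ℝ] T), (postComp f ^ k) B x y = (f ^ k) (B x y) := by
      intro k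
      induction k with
      | zero => simp
      | succ k ih => intro B; simp [pow_succ, ih]
    simp [aeval_monomial, h, Module.algebraMap_end_apply]

theorem aeval_preCompLeft (f : Module.End ℝ T) (P : ℝ[X]) :
    aeval (preCompLeft f) P = preCompLeft (aeval f P) := by
  ext B x y
  induction P using Polynomial.induction_on' with
  | add p q hp hq => simp_all
  | monomial k r =>
    have h : ∀ (k : ℕ) (B : T →ₗ[ℝ] T →ₗ[ℝ] T), (preCompLeft f ^ k) B x y = B ((f ^ k) x) y := by
      intro k
      induction k with
      | zero => simp
      | succ k ih => intro B; rw [pow_succ, pow_succ']; simp [ih]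
    simp [aeval_monomial, h, Module.algebraMap_end_apply]

theorem aeval_preCompRight (f : Module.End ℝ T) (P : ℝ[X]) :
    aeval (preCompRight f) P = preCompRight (aeval f P) := by
  ext B x y
  induction P using Polynomial.induction_on' with
  | add p q hp hq => simp_all
  | monomial k r =>
    have h : ∀ (k : ℕ) (B : T →ₗ[ℝ] T →ₗ[ℝ] T), (preCompRight f ^ k) B x y = B x ((f ^ k) y) := by
      intro k
      induction k with
      | zero => simp
      | succ k ih => intro B; rw [pow_succ, pow_succ']; simp [ih]
    simp [aeval_monomial, h, Module.algebraMap_end_apply]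

/-- The operator `B ↦ (f B(x, y) - B(f x, y) - B(x, f y))` on bilinear maps; through derived
brackets it corresponds to the adjoint action of a lift of `f`. -/
def bilinearAd (f : Module.End ℝ T) : Module.End ℝ (T →ₗ[ℝ] T →ₗ[ℝ] T) :=
  postComp f - preCompLeft f - preCompRight f

theorem bilinearAd_apply (f : Module.End ℝ T) (B : T →ₗ[ℝ] T →ₗ[ℝ] T) (x y : T) :
    bilinearAd f B x y = f (B x y) - B (f x) y - B x (f y) := rfl

/-- The value on a bilinear map of a polynomial in `bilinearAd f`. -/
def polynomialBilinearAd (f : Module.End ℝ T) (P : ℝ[X]) (B : T →ₗ[ℝ] T →ₗ[ℝ] T) :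
    T →ₗ[ℝ] T →ₗ[ℝ] T :=
  aeval (bilinearAd f) P B

/-- A linear relation between vectors and bilinear maps that is preserved by the pair of an
endomorphism `F` and `bilinearAd f` is preserved by every polynomial in this pair. -/
theorem aeval_apply_polynomialBilinearAd_rel {V : Type*} [AddCommGroup V] [Module ℝ V]
    {F : Module.End ℝ V} {f : Module.End ℝ T} (R : V → (T →ₗ[ℝ] T →ₗ[ℝ] T) → Prop)
    (hadd : ∀ v v' B B', R v B → R v' B' → R (v + v') (B + B'))
    (hsmul : ∀ (c : ℝ) v B, R v B → R (c • v) (c • B))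
    (hR : ∀ v B, R v B → R (F v) (bilinearAd f B)) {v : V} {B : T →ₗ[ℝ] T →ₗ[ℝ] T} (h : R v B)
    (P : ℝ[X]) : R (aeval F P v) (polynomialBilinearAd f P B) := by
  rw [polynomialBilinearAd]
  induction P using Polynomial.induction_on with
  | C c => simpa [Module.algebraMap_end_apply] using hsmul c v B h
  | add p q hp hq => simpa using hadd _ _ _ _ hp hq
  | monomial k c ih =>
    rw [pow_succ', mul_left_comm, map_mul _ X, map_mul _ X, aeval_X, aeval_X]
    exact hR _ _ ih

/-- The algebraic core of the theorem, for an arbitrary bilinear map `B` in place of the Dorfman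
bracket.  On simultaneous eigenspaces the hypothesis on `B` says that the eigenvalues `l` of the
value and `m`, `k` of the arguments satisfy `(m + k) (l - m) (l - k) = 0` wherever `B` does not
vanish, and then `l - m - k` is one of `l`, `-k`, `-m`, a root of `P` in each case. -/
theorem polynomialBilinearAd_eq_zero {P : ℝ[X]} (hP : Squarefree P) {f : Module.End ℝ T}
    (hf : aeval f P = 0) (hf' : aeval (-f) P = 0) {B : T →ₗ[ℝ] T →ₗ[ℝ] T}
    (hB : ∀ x y, f (f (B (f x) y)) + B (f (f x)) (f y) - f (B (f (f x)) y + B (f x) (f y)) +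
      (f (f (B x (f y))) + B (f x) (f (f y)) - f (B (f x) (f y) + B x (f (f y)))) = 0) :
    polynomialBilinearAd f P B = 0 := by
  have hl : -preCompLeft f = preCompLeft (-f) := by ext; simp
  have hr : -preCompRight f = preCompRight (-f) := by ext; simp
  refine aeval_sub_sub_apply_eq_zero hP (by ext; rfl) (by ext; rfl) (by ext; rfl) ?_ ?_ ?_ ?_
  · rw [aeval_postComp, hf]
    ext; simp
  · rw [hl, aeval_preCompLeft, hf']
    ext; simp
  · rw [hr, aeval_preCompRight, hf']
    ext; simp
  · ext x y
    rw [LinearMap.zero_apply, LinearMap.zero_apply, ← hB x y]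
    simp
    abel

end BilinearMaps

/-! ### Derived brackets of polynomials in the adjoint action of a lift -/

section GradedCommutators
variable {A L : Type*} [CommRing A] [Algebra ℝ A] [LieRing L] [LieAlgebra ℝ L] [Module A L]
  [LieRingModule L A] [LieRinehartRing A L] [LieRinehartAlgebra ℝ A L]

/-- An operator is odd if it reverses the parity of the degree of forms. -/
def IsOdd (B : Operator A L) : Prop := parity * B = -(B * parity)

theorem parity_mul_parity : (parity * parity : Operator A L) = 1 := by
  ext1 θ
  refine Forms.ext fun k => ?_
  simp [parity_component, smul_smul, ← pow_add, ← two_mul]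

theorem oddPart_of_isEven {B : Operator A L} (hB : IsEven B) : oddPart B = 0 := by
  rw [oddPart, hB, mul_assoc, parity_mul_parity, mul_one, sub_self, smul_zero]

theorem oddPart_of_isOdd {B : Operator A L} (hB : IsOdd B) : oddPart B = B := by
  rw [oddPart, hB, neg_mul, mul_assoc, parity_mul_parity, mul_one, sub_neg_eq_add, ← two_smul ℝ B,
    smul_smul]
  norm_num

theorem gradedCommutator_of_isEven_left {C : Operator A L} (hC : IsEven C) (B : Operator A L) :
    gradedCommutator C B = C * B - B * C := by
  rw [gradedCommutator, oddPart_of_isEven hC, mul_zero, smul_zero, add_zero]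

theorem gradedCommutator_of_isOdd {C B : Operator A L} (hC : IsOdd C) (hB : IsOdd B) :
    gradedCommutator C B = C * B + B * C := by
  rw [gradedCommutator, oddPart_of_isOdd hC, oddPart_of_isOdd hB, two_smul]
  abel

theorem IsOdd.add {B C : Operator A L} (hB : IsOdd B) (hC : IsOdd C) : IsOdd (B + C) := by
  rw [IsOdd, mul_add, hB, hC, add_mul, neg_add]

theorem IsOdd.smul {B : Operator A L} (c : ℝ) (hB : IsOdd B) : IsOdd (c • B) := by
  rw [IsOdd, mul_smul_comm, hB, smul_mul_assoc, smul_neg]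

theorem IsOdd.mul {B C : Operator A L} (hB : IsOdd B) (hC : IsOdd C) : IsEven (B * C) := by
  rw [IsEven, ← mul_assoc, hB, neg_mul, mul_assoc, hC, mul_neg, neg_neg, mul_assoc]

theorem IsEven.add {B C : Operator A L} (hB : IsEven B) (hC : IsEven C) : IsEven (B + C) := by
  rw [IsEven, mul_add, hB, hC, add_mul]

theorem IsEven.sub {B C : Operator A L} (hB : IsEven B) (hC : IsEven C) : IsEven (B - C) := by
  rw [IsEven, mul_sub, hB, hC, sub_mul]

theorem IsEven.smul {B : Operator A L} (c : ℝ) (hB : IsEven B) : IsEven (c • B) := by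
  rw [IsEven, mul_smul_comm, hB, smul_mul_assoc]

theorem IsOdd.commutator {C B : Operator A L} (hC : IsEven C) (hB : IsOdd B) :
    IsOdd (C * B - B * C) := by
  rw [IsOdd, mul_sub, ← mul_assoc, ← mul_assoc, hC, hB, neg_mul, mul_assoc, mul_assoc, hB, hC]
  noncomm_ring

theorem isOdd_deRham : IsOdd (deRham A L) := by
  rw [IsOdd]
  ext1 θ
  refine Forms.ext fun k => ?_
  cases k with
  | zero => simp [parity_component, deRham_component_zero]
  | succ k =>
    rw [Module.End.mul_apply, LinearMap.neg_apply, Module.End.mul_apply, Forms.component_neg,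
      parity_component, deRham_component_succ, deRham_component_succ, parity_component,
      DForm.extDeriv_smul, pow_succ, mul_neg_one]
    exact neg_smul ((-1 : ℝ) ^ k) (DForm.extDeriv (θ.component k))

theorem isOdd_clifford (x : GenTangent A L) : IsOdd (clifford x) := by
  have h1 : IsOdd (contraction x.1 : Operator A L) := by
    rw [IsOdd]
    ext1 θ
    refine Forms.ext fun k => ?_
    ext v
    simp [parity_component, contraction_component, pow_succ]
  have h2 : IsOdd (wedge x.2) := by
    rw [IsOdd]
    ext1 θ
    refine Forms.ext fun k => ?_
    cases k with
    | zero => simp [parity_component, wedge_component_zero]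
    | succ k =>
      ext v
      simp [parity_component, wedge_component_succ, pow_succ, Finset.smul_sum]
  exact h1.add h2

theorem isEven_mulFunction (f : A) : IsEven (mulFunction f : Operator A L) := by
  rw [IsEven]
  ext1 θ
  refine Forms.ext fun k => ?_
  simp [parity_component, mulFunction_component, smul_comm f]

theorem derivedBracket_clifford {D : Operator A L} (hD : IsOdd D) (x y : GenTangent A L) :
    derivedBracket D (clifford x) (clifford y) =
      (clifford x * D + D * clifford x) * clifford y -
        clifford y * (clifford x * D + D * clifford x) := by
  have hx := isOdd_clifford x
  rw [derivedBracket, gradedCommutator_of_isOdd hx hD,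
    gradedCommutator_of_isEven_left ((hx.mul hD).add (hD.mul hx))]

variable (A L) in
/-- The Dorfman bracket as a real bilinear map. -/
def dorfmanBilinear : GenTangent A L →ₗ[ℝ] GenTangent A L →ₗ[ℝ] GenTangent A L :=
  LinearMap.mk₂ ℝ dorfman
    (fun x x' y => by
      refine Prod.ext (add_lie _ _ _) ?_
      ext Z
      simp [dorfman, lieDerivative, contractDeriv]
      abel)
    (fun c x y => by
      refine Prod.ext (smul_lie _ _ _) ?_
      ext Z
      simp [dorfman, lieDerivative, contractDeriv, smul_sub])
    (fun x y y' => by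
      refine Prod.ext (lie_add _ _ _) ?_
      ext Z
      simp [dorfman, lieDerivative, contractDeriv]
      abel)
    (fun c x y => by
      refine Prod.ext (lie_smul _ _ _) ?_
      ext Z
      simp [dorfman, lieDerivative, contractDeriv, smul_sub])

@[simp] theorem dorfmanBilinear_apply (x y : GenTangent A L) :
    dorfmanBilinear A L x y = dorfman x y := rfl

/-- The derived bracket of the odd operator `D` restricts to the bilinear map `B` on sections of the
generalized tangent bundle. -/
structure HasDerivedBracket (D : Operator A L)
    (B : GenTangent A L →ₗ[ℝ] GenTangent A L →ₗ[ℝ] GenTangent A L) : Prop where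
  isOdd : IsOdd D
  derivedBracket_eq : ∀ x y, derivedBracket D (clifford x) (clifford y) = clifford (B x y)

variable {D D' : Operator A L} {B B' : GenTangent A L →ₗ[ℝ] GenTangent A L →ₗ[ℝ] GenTangent A L}

theorem hasDerivedBracket_deRham : HasDerivedBracket (deRham A L) (dorfmanBilinear A L) where
  isOdd := isOdd_deRham
  derivedBracket_eq x y := by
    rw [derivedBracket_clifford isOdd_deRham, clifford_deRham_clifford, dorfmanBilinear_apply]

theorem HasDerivedBracket.add (h : HasDerivedBracket D B) (h' : HasDerivedBracket D' B') :
    HasDerivedBracket (D + D') (B + B') where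
  isOdd := h.isOdd.add h'.isOdd
  derivedBracket_eq x y := by
    rw [LinearMap.add_apply, LinearMap.add_apply, clifford_add, ← h.derivedBracket_eq,
      ← h'.derivedBracket_eq, derivedBracket_clifford h.isOdd, derivedBracket_clifford h'.isOdd,
      derivedBracket_clifford (h.isOdd.add h'.isOdd)]
    noncomm_ring

theorem HasDerivedBracket.smul (c : ℝ) (h : HasDerivedBracket D B) :
    HasDerivedBracket (c • D) (c • B) where
  isOdd := h.isOdd.smul c
  derivedBracket_eq x y := by
    have hc : clifford (c • B x y) = c • clifford (B x y) := map_smul (cliffordLinear A L) c _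
    rw [LinearMap.smul_apply, LinearMap.smul_apply, hc, ← h.derivedBracket_eq,
      derivedBracket_clifford h.isOdd,
      derivedBracket_clifford (h.isOdd.smul c)]
    simp only [mul_smul_comm, smul_mul_assoc, ← smul_add, ← smul_sub]

theorem IsLift.commutator_clifford {φ : Module.End A (GenTangent A L)} {Φ : Operator A L}
    (hΦ : IsLift φ Φ) (x : GenTangent A L) :
    Φ * clifford x - clifford x * Φ = clifford (φ x) := by
  rw [← gradedCommutator_of_isEven_left hΦ.even, hΦ.comm_clifford]

/-- The adjoint action of a lift is a derivation, and on sections it is the bundle endomorphism. -/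
theorem HasDerivedBracket.gradedAd {φ : Module.End A (GenTangent A L)} {Φ : Operator A L}
    (hΦ : IsLift φ Φ) (h : HasDerivedBracket D B) :
    HasDerivedBracket (gradedAd Φ D) (bilinearAd (φ.restrictScalars ℝ) B) := by
  have hD : GeneralizedGeometry.gradedAd Φ D = Φ * D - D * Φ :=
    gradedCommutator_of_isEven_left hΦ.even D
  have hodd : IsOdd (Φ * D - D * Φ) := h.isOdd.commutator hΦ.even
  rw [hD]
  refine ⟨hodd, fun x y => ?_⟩
  have hB := h.derivedBracket_eq
  simp only [derivedBracket_clifford h.isOdd] at hB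
  have hsub (u w : GenTangent A L) : clifford (u - w) = clifford u - clifford w :=
    map_sub (cliffordLinear A L) u w
  simp only [bilinearAd_apply, hsub, LinearMap.restrictScalars_apply]
  rw [← hΦ.commutator_clifford, ← hB, ← hB, ← hB, ← hΦ.commutator_clifford,
    ← hΦ.commutator_clifford, derivedBracket_clifford hodd]
  noncomm_ring

theorem hasDerivedBracket_minimalOperator {φ : Module.End A (GenTangent A L)} {Φ : Operator A L}
    (hΦ : IsLift φ Φ) (P : Polynomial ℝ) :
    HasDerivedBracket (minimalOperator Φ P)
      (polynomialBilinearAd (φ.restrictScalars ℝ) P (dorfmanBilinear A L)) :=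
  aeval_apply_polynomialBilinearAd_rel (V := Operator A L) (T := GenTangent A L)
    (F := gradedAd Φ) (f := φ.restrictScalars ℝ) (fun D B => HasDerivedBracket D B)
    (fun _ _ _ _ => HasDerivedBracket.add) (fun c _ _ => HasDerivedBracket.smul c)
    (fun _ _ => HasDerivedBracket.gradedAd hΦ) hasDerivedBracket_deRham P

/-- A weak Nijenhuis operator that is, up to sign, annihilated by a squarefree polynomial is
minimal, provided that it has a lift. -/
theorem derivedBracket_minimalOperator_eq_zero {φ : Module.End A (GenTangent A L)}
    {Φ : Operator A L} (hΦ : IsLift φ Φ) (hN : IsWeakNijenhuis φ) {P : Polynomial ℝ}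
    (hP : Squarefree P) (h : Polynomial.aeval (φ.restrictScalars ℝ) P = 0)
    (h' : Polynomial.aeval (-φ.restrictScalars ℝ) P = 0) (x y : GenTangent A L) :
    derivedBracket (minimalOperator Φ P) (clifford x) (clifford y) = 0 := by
  rw [(hasDerivedBracket_minimalOperator hΦ P).derivedBracket_eq,
    polynomialBilinearAd_eq_zero (B := dorfmanBilinear A L) hP h h' fun x y => hN x y]
  exact map_zero (cliffordLinear A L)

end GradedCommutators

/-! ### The lift over a frame -/

section LocalLift
variable {A L : Type*} [CommRing A] [Algebra ℝ A] [LieRing L] [LieAlgebra ℝ L] [Module A L]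
  [LieRingModule L A] [LieRinehartRing A L] [LieRinehartAlgebra ℝ A L]

/-- Twice the tautological inner product, `α(Y) + β(X)`. -/
def dot (x y : GenTangent A L) : A := x.2 y.1 + y.2 x.1

theorem dot_eq_two_smul_pairing (x y : GenTangent A L) : dot x y = (2 : ℝ) • pairing x y := by
  rw [pairing, smul_smul]
  norm_num [dot]

variable (A L) in
/-- `dot` as a real bilinear map. -/
def dotBilinear : GenTangent A L →ₗ[ℝ] GenTangent A L →ₗ[ℝ] A :=
  LinearMap.mk₂ ℝ dot
    (fun x x' y => by simp [dot]; abel)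
    (fun c x y => by simp [dot, LinearMap.map_smul_of_tower])
    (fun x y y' => by simp [dot]; abel)
    (fun c x y => by simp [dot, LinearMap.map_smul_of_tower])

theorem IsSkew.dot_left {φ : Module.End A (GenTangent A L)} (hφ : IsSkew φ)
    (x y : GenTangent A L) : dot (φ x) y = -dot x (φ y) := by
  rw [dot_eq_two_smul_pairing, dot_eq_two_smul_pairing, ← smul_neg,
    eq_neg_of_add_eq_zero_left (hφ x y)]

theorem clifford_mul_clifford_commutator (u w x : GenTangent A L) :
    clifford u * clifford w * clifford x - clifford x * (clifford u * clifford w) =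
      clifford (dot w x • u - dot u x • w) := by
  have h1 := clifford_anticomm w x
  have h2 := clifford_anticomm u x
  have hs : clifford (dot w x • u - dot u x • w) =
      clifford (dot w x • u) - clifford (dot u x • w) := map_sub (cliffordLinear A L) _ _
  rw [hs, clifford_smul, clifford_smul, dot, dot, ← h1, ← h2, h1, ← clifford_mul_mulFunction, ← h1]
  noncomm_ring

theorem clifford_component_zero (x : GenTangent A L) (θ : Forms A L) (v : Fin 0 → L) :
    (clifford x θ).component 0 v = θ.component 1 (Fin.cons x.1 v) :=
  add_zero _

theorem clifford_component_succ (x : GenTangent A L) (θ : Forms A L) (k : ℕ)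
    (v : Fin (k + 1) → L) :
    (clifford x θ).component (k + 1) v = θ.component (k + 2) (Fin.cons x.1 v) +
      ∑ i : Fin (k + 1), (-1) ^ (i : ℕ) • (x.2 (v i) * θ.component k (i.removeNth v)) := by
  rw [← wedge_component_succ]
  rfl

theorem clifford_clifford_constOne_component (u w : GenTangent A L) {k : ℕ} (h0 : k ≠ 0)
    (h2 : k ≠ 2) : (clifford u (clifford w constOne)).component k = 0 := by
  have hone : ∀ j, (constOne : Forms A L).component (j + 1) = 0 := fun _ => rfl
  have h1 : ∀ j, j ≠ 1 → (clifford w (constOne : Forms A L)).component j = 0 := by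
    intro j hj
    ext v
    rcases j with _ | j
    · simp [clifford_component_zero, hone]
    · obtain ⟨j, rfl⟩ := Nat.exists_eq_succ_of_ne_zero (n := j) (by omega)
      simp [clifford_component_succ, hone]
  obtain ⟨k, rfl⟩ := Nat.exists_eq_succ_of_ne_zero h0
  ext v
  simp [clifford_component_succ u, h1 k (by omega), h1 (k + 2) (by omega)]

/-- If `Y i`, `α i` are vector fields and `1`-forms with `∑ i, α i (X) Y i = g X` for all `X`, a
skew-symmetric bundle endomorphism `φ` has a lift up to the factor `g`.  It is half the sum of the
products of Clifford operators given by the `2`-vector of `φ`, corrected by a function in order to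
map the constant function `1` to a `2`-form. -/
theorem exists_lift_of_frame {ι : Type*} [Fintype ι] (Y : ι → L) (α : ι → Module.Dual A L) (g : A)
    (hY : ∀ X, ∑ i, α i X • Y i = g • X) {φ : Module.End A (GenTangent A L)} (hφ : IsSkew φ) :
    ∃ Ψ : Operator A L, IsEven Ψ ∧ (∀ f, Ψ * mulFunction f = mulFunction f * Ψ) ∧
      (∀ x, Ψ * clifford x - clifford x * Ψ = mulFunction g * clifford (φ x)) ∧
      ∀ k ≠ 2, (Ψ constOne).component k = 0 := by
  -- The sections `e`, `e'` form a frame of the generalized tangent bundle, and with respect to `dot`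
  -- the dual frame is `e'`, `e`, up to the factor `g`.
  let e : ι → GenTangent A L := fun i => (Y i, 0)
  let e' : ι → GenTangent A L := fun i => (0, α i)
  have hexp : ∀ x, ∑ i, (dot (e' i) x • e i + dot (e i) x • e' i) = g • x := by
    intro x
    refine Prod.ext ?_ ?_
    · simp [e, e', dot, Prod.fst_sum, hY]
    · ext Z
      have := congrArg x.2 (hY Z)
      simpa [e, e', dot, Prod.snd_sum, mul_comm] using this
  let Q : Operator A L := (1 / 2 : ℝ) • ∑ i,
    (clifford (φ (e i)) * clifford (e' i) + clifford (φ (e' i)) * clifford (e i))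
  have hQe : IsEven Q := by
    rw [IsEven]
    simp only [Q, mul_smul_comm, smul_mul_assoc, Finset.mul_sum, Finset.sum_mul]
    congr 1
    exact Finset.sum_congr rfl fun i _ => (((isOdd_clifford _).mul (isOdd_clifford _)).add
      ((isOdd_clifford _).mul (isOdd_clifford _)))
  have hQf : ∀ f, Q * mulFunction f = mulFunction f * Q := by
    intro f
    simp only [Q, mul_smul_comm, smul_mul_assoc, Finset.mul_sum, Finset.sum_mul, mul_add, add_mul,
      mul_assoc, clifford_mul_mulFunction]
    simp only [← mul_assoc, clifford_mul_mulFunction]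
  have hQx : ∀ x, Q * clifford x - clifford x * Q = mulFunction g * clifford (φ x) := by
    intro x
    have h1 : Q * clifford x - clifford x * Q = (1 / 2 : ℝ) • ∑ i,
        clifford ((dot (e' i) x • φ (e i) - dot (φ (e i)) x • e' i) +
          (dot (e i) x • φ (e' i) - dot (φ (e' i)) x • e i)) := by
      simp only [Q, mul_smul_comm, smul_mul_assoc, Finset.mul_sum, Finset.sum_mul, ← smul_sub,
        ← Finset.sum_sub_distrib]
      congr 1
      refine Finset.sum_congr rfl fun i _ => ?_
      rw [clifford_add, ← clifford_mul_clifford_commutator, ← clifford_mul_clifford_commutator]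
      noncomm_ring
    have h2 : ∑ i, ((dot (e' i) x • φ (e i) - dot (φ (e i)) x • e' i) +
          (dot (e i) x • φ (e' i) - dot (φ (e' i)) x • e i)) = (2 : ℝ) • g • φ x := by
      rw [two_smul]
      nth_rewrite 1 [← map_smul]
      rw [← hexp, ← hexp, map_sum, ← Finset.sum_add_distrib]
      refine Finset.sum_congr rfl fun i _ => ?_
      rw [hφ.dot_left, hφ.dot_left, map_add, map_smul, map_smul]
      module
    have h3 : ∀ F : ι → GenTangent A L, ∑ i, clifford (F i) = clifford (∑ i, F i) := fun F =>
      (map_sum (cliffordLinear A L) F _).symm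
    have h4 : clifford ((2 : ℝ) • g • φ x) = (2 : ℝ) • clifford (g • φ x) :=
      map_smul (cliffordLinear A L) _ _
    rw [h1, h3, h2, h4, smul_smul, clifford_smul]
    norm_num
  -- `Q` maps `1` to the sum of a `2`-form and the function `h`; subtracting `h` does not affect the
  -- commutators, as functions commute with Clifford operators.
  let h : A := (Q constOne).component 0 Fin.elim0
  refine ⟨Q - mulFunction h, hQe.sub (isEven_mulFunction h), fun f => ?_, fun x => ?_,
    fun k hk => ?_⟩
  · rw [sub_mul, mul_sub, hQf, ← mulFunction_mul, ← mulFunction_mul, mul_comm h f]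
  · rw [← hQx x, sub_mul, mul_sub, clifford_mul_mulFunction]
    abel
  · rcases eq_or_ne k 0 with rfl | h0
    · ext v
      have hv : v = Fin.elim0 := Subsingleton.elim _ _
      simp [hv, h, mulFunction_component, constOne]
    · have h1 : (Q constOne).component k = 0 := by
        simp only [Q, LinearMap.smul_apply, Forms.component_smul, LinearMap.sum_apply,
          Forms.component_sum, LinearMap.add_apply, Forms.component_add, Module.End.mul_apply,
          clifford_clifford_constOne_component _ _ h0 hk, add_zero, Finset.sum_const_zero,
          smul_zero]
      obtain ⟨j, rfl⟩ := Nat.exists_eq_succ_of_ne_zero h0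
      rw [LinearMap.sub_apply, Forms.component_sub, h1, mulFunction_component]
      exact (zero_sub _).trans (neg_eq_zero.2 (smul_zero h))

end LocalLift

/-! ### Local frames of vector fields -/

section LocalFrames
variable {n : ℕ} {M : Type*} [TopologicalSpace M]
  [ChartedSpace (EuclideanSpace ℝ (Fin n)) M] [IsManifold (𝓡 n) ∞ M]

/-- Every tangent vector extends to a global vector field, by a local extension cut off with a bump
function. -/
theorem exists_vectorField_apply_eq [T2Space M] (p : M) (v : TangentSpace (𝓡 n) p) :
    ∃ X : SmoothVectorField n M, X p = v := by
  obtain ⟨s, hs, hsm⟩ := FiberBundle.exists_contMDiffOn_extend (k := ∞) (𝓡 n)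
    (EuclideanSpace ℝ (Fin n)) v
  obtain ⟨t, hts, hto, hpt⟩ := mem_nhds_iff.1 hs
  obtain ⟨χ, hχ⟩ := ((SmoothBumpFunction.nhds_basis_tsupport (I := 𝓡 n) p).mem_iff).1
    (hto.mem_nhds hpt)
  refine ⟨⟨_, ContMDiffOn.smul_section_of_tsupport χ.contMDiff.contMDiffOn hto hχ.2
    (hsm.mono hts)⟩, ?_⟩
  change χ p • FiberBundle.extend (EuclideanSpace ℝ (Fin n)) v p = v
  rw [χ.eq_one, one_smul, FiberBundle.extend_apply_self]

/-- Every cotangent vector is the differential of a global function: a linear function of the chart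
coordinates, cut off by a bump function. -/
theorem exists_function_differential_eq [T2Space M] (p : M)
    (l : TangentSpace (𝓡 n) p →L[ℝ] ℝ) :
    ∃ f : SmoothFunction n M, mvfderiv (𝓡 n) f p = l := by
  let E := EuclideanSpace ℝ (Fin n)
  obtain ⟨e, he⟩ := isInvertible_mfderiv_extChartAt (I := 𝓡 n) (mem_extChartAt_source p)
  let l' : E →L[ℝ] ℝ := l ∘L (e.symm : _ →L[ℝ] _) ∘L
    ((NormedSpace.fromTangentSpace (𝕜 := ℝ) (extChartAt (𝓡 n) p p)).symm :
      E →L[ℝ] TangentSpace 𝓘(ℝ, E) (extChartAt (𝓡 n) p p))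
  obtain ⟨χ, -⟩ := (SmoothBumpFunction.nhds_basis_tsupport (I := 𝓡 n) p).ex_mem
  have hsm : ContMDiffOn (𝓡 n) 𝓘(ℝ, ℝ) ∞ (fun q => l' (extChartAt (𝓡 n) p q))
      (chartAt E p).source :=
    l'.contMDiff.comp_contMDiffOn contMDiffOn_extChartAt
  refine ⟨⟨_, χ.contMDiff_smul hsm⟩, ?_⟩
  have hev : (fun q => χ q • l' (extChartAt (𝓡 n) p q)) =ᶠ[nhds p]
      l' ∘ extChartAt (𝓡 n) p := by
    filter_upwards [χ.eventuallyEq_one] with q hq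
    simp [hq]
  ext v
  change mfderiv (𝓡 n) 𝓘(ℝ, ℝ) (fun q => χ q • l' (extChartAt (𝓡 n) p q)) p v = l v
  rw [hev.mfderiv_eq, mfderiv_comp (I' := 𝓘(ℝ, E)) p l'.mdifferentiableAt
    (mdifferentiableAt_extChartAt (mem_chart_source _ p)),
    ContinuousLinearMap.mfderiv_eq, ← he]
  change l (e.symm (e v)) = l v
  rw [e.symm_apply_apply]

/-- Around every point there is a finite frame of vector fields with its dual frame.  The frame
consists of vector fields `Y i`, and the dual frame is obtained from functions `f j` by inverting
the matrix `(Y i (f j))` with the adjugate; multiplying by the determinant once more makes the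
expansion hold on all of `M`, as both sides vanish where the determinant does. -/
theorem exists_frame [T2Space M] (p : M) :
    ∃ (Y : Fin n → SmoothVectorField n M)
      (α : Fin n → Module.Dual (SmoothFunction n M) (SmoothVectorField n M))
      (g : SmoothFunction n M), (∀ X, ∑ i, α i X • Y i = g • X) ∧ g p ≠ 0 := by
  have hfin (q : M) : Module.Finite ℝ (TangentSpace (𝓡 n) q) :=
    inferInstanceAs (Module.Finite ℝ (EuclideanSpace ℝ (Fin n)))
  have : T2Space (TangentSpace (𝓡 n) p) :=
    inferInstanceAs (T2Space (EuclideanSpace ℝ (Fin n)))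
  have hdim (q : M) : Module.finrank ℝ (TangentSpace (𝓡 n) q) = n :=
    finrank_euclideanSpace_fin (𝕜 := ℝ) (n := n)
  let b : Module.Basis (Fin n) ℝ (TangentSpace (𝓡 n) p) :=
    Module.finBasisOfFinrankEq ℝ _ (hdim p)
  choose Y hY using fun i => exists_vectorField_apply_eq (n := n) p (b i)
  choose f hf using fun j => exists_function_differential_eq (n := n) p
    (b.coord j).toContinuousLinearMap
  let G : Matrix (Fin n) (Fin n) (SmoothFunction n M) := fun i j => ⁅Y i, f j⁆
  let ev (q : M) : SmoothFunction n M →+* ℝ := ContMDiffMap.evalRingHom q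
  refine ⟨Y, fun k => G.det • ∑ j, G.adjugate j k • differential (f j), G.det * G.det, ?_, ?_⟩
  · intro X
    -- Where the determinant does not vanish, the differentials of the `f j` are jointly injective on
    -- the tangent space, so that it suffices to compare the derivatives of the `f m`.
    have key : ∀ q, ev q G.det ≠ 0 →
        (∑ k, (∑ j, G.adjugate j k • ⁅X, f j⁆) • Y k) q = (G.det • X) q := by
      intro q hq
      let T : TangentSpace (𝓡 n) q →ₗ[ℝ] (Fin n → ℝ) :=
        LinearMap.pi fun j => (mvfderiv (𝓡 n) (f j) q).toLinearMap
      have hT (Z : SmoothVectorField n M) : T (Z q) = fun j => ev q ⁅Z, f j⁆ := rfl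
      have hGq : ((ev q).mapMatrix G).det ≠ 0 := by rwa [← RingHom.map_det]
      have hsurj : Function.Surjective T := by
        intro c
        refine ⟨∑ i, (Matrix.vecMul c ((ev q).mapMatrix G)⁻¹) i • Y i q, ?_⟩
        rw [map_sum]
        simp only [map_smul, hT]
        have : Matrix.vecMul (Matrix.vecMul c ((ev q).mapMatrix G)⁻¹) ((ev q).mapMatrix G) = c := by
          rw [Matrix.vecMul_vecMul, Matrix.nonsing_inv_mul _ (isUnit_iff_ne_zero.2 hGq),
            Matrix.vecMul_one]
        nth_rewrite 2 [← this]
        ext j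
        simp only [Finset.sum_apply, Pi.smul_apply, smul_eq_mul]
        rfl
      have hinj : Function.Injective T :=
        (LinearMap.injective_iff_surjective_of_finrank_eq_finrank (by simp [hdim])).2 hsurj
      apply hinj
      rw [hT, hT]
      ext m
      have hlie : ∀ (F : Fin n → SmoothVectorField n M), ⁅∑ k, F k, f m⁆ = ∑ k, ⁅F k, f m⁆ :=
        fun F => map_sum (differential (f m)) F Finset.univ
      rw [hlie]
      simp only [LieRinehartRing.lie_smul_eq_mul]
      congr 1
      have hadj : ∀ j, ∑ k, G.adjugate j k * G k m = if j = m then G.det else 0 := by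
        intro j
        have := congrFun (congrFun G.adjugate_mul j) m
        simpa [Matrix.mul_apply, Matrix.one_apply] using this
      calc ∑ k, (∑ j, G.adjugate j k • ⁅X, f j⁆) * ⁅Y k, f m⁆
          = ∑ j, ⁅X, f j⁆ * ∑ k, G.adjugate j k * G k m := by
            simp only [Finset.sum_mul, Finset.mul_sum]
            rw [Finset.sum_comm]
            refine Finset.sum_congr rfl fun j _ => Finset.sum_congr rfl fun k _ => ?_
            simp only [smul_eq_mul, G]
            ring
        _ = G.det * ⁅X, f m⁆ := by
            simp only [hadj, mul_ite, mul_zero, Finset.sum_ite_eq',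
              Finset.mem_univ, if_true, mul_comm G.det]
    have h1 : ∑ k, (G.det • ∑ j, G.adjugate j k • differential (f j)) X • Y k =
        G.det • ∑ k, (∑ j, G.adjugate j k • ⁅X, f j⁆) • Y k := by
      rw [Finset.smul_sum]
      refine Finset.sum_congr rfl fun k _ => ?_
      simp [mul_smul]
    rw [h1, mul_smul]
    ext q
    rw [smooth_smul_apply, smooth_smul_apply]
    by_cases hq : ev q G.det = 0
    · change G.det q = 0 at hq
      rw [hq, zero_smul, zero_smul]
    · rw [key q hq]
  · have h1 : ev p G.det = 1 := by
      rw [RingHom.map_det]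
      have h2 : (ev p).mapMatrix G = 1 := by
        ext i j
        change mvfderiv (𝓡 n) (f j) p (Y i p) = _
        rw [hf, hY]
        simp [Matrix.one_apply, Finsupp.single_apply]
      rw [h2, Matrix.det_one]
    change ev p (G.det * G.det) ≠ 0
    rw [map_mul, h1]
    norm_num

end LocalFrames

/-! ### Gluing of local lifts -/

section Gluing
variable {n : ℕ} {M : Type*} [TopologicalSpace M]
  [ChartedSpace (EuclideanSpace ℝ (Fin n)) M] [IsManifold (𝓡 n) ∞ M]

/-- Evaluation of smooth functions at a point. -/
def evalAt (p : M) : SmoothFunction n M →ₐ[ℝ] ℝ where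
  __ := ContMDiffMap.evalRingHom p
  commutes' _ := rfl

theorem evalAt_apply (p : M) (f : SmoothFunction n M) : evalAt p f = f p := rfl

variable (n M) in
/-- The differential forms on `M`. -/
abbrev FormsOn : Type _ := Forms (SmoothFunction n M) (SmoothVectorField n M)

variable (n M) in
/-- The operators on the differential forms on `M`. -/
abbrev OperatorOn : Type _ := Operator (SmoothFunction n M) (SmoothVectorField n M)

/-- Two forms agree at the point `p` if their values on vector fields do. -/
def AgreeAt (p : M) (θ η : FormsOn n M) : Prop :=
  ∀ k v, evalAt p (θ.component k v) = evalAt p (η.component k v)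

variable {p : M} {θ θ' η η' : FormsOn n M}

theorem forms_ext_of_agreeAt (h : ∀ p : M, AgreeAt p θ η) : θ = η :=
  Forms.ext fun k => AlternatingMap.ext fun v => ContMDiffMap.ext fun p => h p k v

theorem AgreeAt.trans (h : AgreeAt p θ η) (h' : AgreeAt p η η') : AgreeAt p θ η' :=
  fun k v => (h k v).trans (h' k v)

theorem AgreeAt.symm (h : AgreeAt p θ η) : AgreeAt p η θ := fun k v => (h k v).symm

theorem AgreeAt.sub (h : AgreeAt p θ η) (h' : AgreeAt p θ' η') :
    AgreeAt p (θ - θ') (η - η') := fun k v => by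
  simp only [Forms.component_sub, AlternatingMap.sub_apply, map_sub, h k v, h' k v]

theorem AgreeAt.parity (h : AgreeAt p θ η) : AgreeAt p (parity θ) (parity η) := fun k v => by
  simp only [parity_component, AlternatingMap.smul_apply, map_smul, h k v]

theorem AgreeAt.mulFunction (f : SmoothFunction n M) (h : AgreeAt p θ η) :
    AgreeAt p (mulFunction f θ) (mulFunction f η) := fun k v => by
  simp only [mulFunction_component, AlternatingMap.smul_apply, smul_eq_mul, map_mul, h k v]

theorem AgreeAt.clifford (x : GenTangentSection n M) (h : AgreeAt p θ η) :
    AgreeAt p (clifford x θ) (clifford x η) := fun k v => by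
  cases k with
  | zero => simp only [clifford_component_zero, h 1]
  | succ k =>
    simp only [clifford_component_succ, map_add, map_sum, map_zsmul, map_mul, h (k + 2), h k]

variable {ι : Type*} (ρ : SmoothPartitionOfUnity ι (𝓡 n) M Set.univ) (w : ι → M → ℝ)
  (hw : ∀ i, ∀ p ∈ tsupport (ρ i), ContMDiffAt (𝓡 n) 𝓘(ℝ, ℝ) ∞ (w i) p)

/-- The locally finite sum of smooth functions with the weights `ρ i * w i`, where the function `w i`
need only be smooth on the support of `ρ i`. -/
def weightedSum (f : ι → SmoothFunction n M) : SmoothFunction n M :=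
  ⟨fun p => ∑ᶠ i, ρ i p • (w i p * f i p),
    ρ.contMDiff_finsum_smul fun i p hp => (hw i p hp).mul (f i).contMDiff.contMDiffAt⟩

theorem evalAt_weightedSum (f : ι → SmoothFunction n M) (p : M) :
    evalAt p (weightedSum ρ w hw f) =
      ∑ i ∈ ρ.finsupport p, (ρ i p * w i p) * evalAt p (f i) := by
  simp only [mul_assoc]
  exact (ρ.sum_finsupport_smul_eq_finsum p fun i p => w i p * f i p).symm

/-- The locally finite sum of operators with the weights `ρ i * w i`. -/
def weightedOperatorSum (Ψ : ι → OperatorOn n M) : OperatorOn n M where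
  toFun θ := Forms.mk fun k =>
    { toFun := fun v => weightedSum ρ w hw fun i => (Ψ i θ).component k v
      map_update_add' := fun v j x y => by
        ext p
        simp only [← evalAt_apply, map_add, evalAt_weightedSum, AlternatingMap.map_update_add,
          mul_add, Finset.sum_add_distrib]
      map_update_smul' := fun v j c x => by
        ext p
        simp only [← evalAt_apply, smul_eq_mul, map_mul, evalAt_weightedSum,
          AlternatingMap.map_update_smul, Finset.mul_sum, mul_left_comm]
      map_eq_zero_of_eq' := fun v i j h hij => by
        ext p
        simp only [← evalAt_apply, evalAt_weightedSum, AlternatingMap.map_eq_zero_of_eq _ v h hij,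
          map_zero, mul_zero, Finset.sum_const_zero] }
  map_add' θ η := forms_ext_of_agreeAt fun p k v => by
    change evalAt p (weightedSum ρ w hw _) =
      evalAt p (weightedSum ρ w hw _ + weightedSum ρ w hw _)
    simp only [map_add, evalAt_weightedSum, Forms.component_add, AlternatingMap.add_apply,
      mul_add, Finset.sum_add_distrib]
  map_smul' c θ := forms_ext_of_agreeAt fun p k v => by
    change evalAt p (weightedSum ρ w hw _) = evalAt p (c • weightedSum ρ w hw _)
    simp only [map_smul, evalAt_weightedSum, Forms.component_smul, AlternatingMap.smul_apply,
      smul_eq_mul, Finset.mul_sum, mul_left_comm c]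

/-- At each point the locally finite sum of operators is a finite linear combination. -/
theorem agreeAt_weightedOperatorSum (Ψ : ι → OperatorOn n M) (p : M) (θ : FormsOn n M) :
    AgreeAt p (weightedOperatorSum ρ w hw Ψ θ)
      ((∑ i ∈ ρ.finsupport p, (ρ i p * w i p) • Ψ i) θ) := fun k v => by
  change evalAt p (weightedSum ρ w hw _) = _
  simp only [evalAt_weightedSum, LinearMap.sum_apply, Forms.component_sum,
    DForm.sum_apply, map_sum, LinearMap.smul_apply, Forms.component_smul,
    AlternatingMap.smul_apply, map_smul, smul_eq_mul]

/-- Being a lift can be checked pointwise, with a different operator `S p` at each point: Clifford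
operators and multiplications by functions preserve agreement at `p`. -/
theorem isLift_of_agreeAt {φ : Module.End (SmoothFunction n M) (GenTangentSection n M)}
    {Φ : OperatorOn n M} (S : M → OperatorOn n M) (hS : ∀ p θ, AgreeAt p (Φ θ) (S p θ))
    (heven : ∀ p, IsEven (S p)) (hf : ∀ p f, S p * mulFunction f = mulFunction f * S p)
    (hx : ∀ p x θ, AgreeAt p ((S p * clifford x - clifford x * S p) θ) (clifford (φ x) θ))
    (hone : ∀ p, ∀ k ≠ 2, (S p constOne).component k = 0) : IsLift φ Φ := by
  have hΦ : IsEven Φ := by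
    ext1 θ
    refine forms_ext_of_agreeAt fun p => ((hS p θ).parity).trans ?_
    refine AgreeAt.trans ?_ (hS p (parity θ)).symm
    rw [← Module.End.mul_apply, heven p]
    exact fun _ _ => rfl
  refine ⟨hΦ, fun f => ?_, fun x => ?_, fun k hk => ?_⟩
  · rw [gradedCommutator_of_isEven_left hΦ, sub_eq_zero]
    ext1 θ
    refine forms_ext_of_agreeAt fun p => AgreeAt.trans (hS p _) ?_
    refine AgreeAt.trans ?_ ((hS p θ).symm.mulFunction f)
    rw [← Module.End.mul_apply, hf p f]
    exact fun _ _ => rfl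
  · rw [gradedCommutator_of_isEven_left hΦ]
    ext1 θ
    exact forms_ext_of_agreeAt fun p =>
      ((hS p _).sub ((hS p θ).clifford x)).trans (hx p x θ)
  · ext v p
    have := hS p constOne k v
    rwa [hone p k hk] at this

/-- Every skew-symmetric bundle endomorphism has a lift. -/
theorem exists_isLift [T2Space M] [SigmaCompactSpace M]
    {φ : Module.End (SmoothFunction n M) (GenTangentSection n M)} (hφ : IsSkew φ) :
    ∃ Φ : OperatorOn n M, IsLift φ Φ := by
  choose Y α g hY hg using exists_frame (n := n) (M := M)
  choose Ψ hΨe hΨf hΨx hΨone using fun p => exists_lift_of_frame (Y p) (α p) (g p) (hY p) hφ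
  obtain ⟨ρ, hρ⟩ := SmoothPartitionOfUnity.exists_isSubordinate (𝓡 n) isClosed_univ
    (fun p : M => {q | g p q ≠ 0}) (fun p => isOpen_ne_fun (g p).contMDiff.continuous
      continuous_const) (fun q _ => Set.mem_iUnion.2 ⟨q, hg q⟩)
  -- The lift over the frame at `p` carries the factor `g p`, which is invertible on the support of
  -- the corresponding function of the partition of unity.
  let w : M → M → ℝ := fun p q => (g p q)⁻¹
  have hw : ∀ i, ∀ p ∈ tsupport (ρ i), ContMDiffAt (𝓡 n) 𝓘(ℝ, ℝ) ∞ (w i) p := fun i p hp =>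
    (g i).contMDiff.contMDiffAt.inv₀ (hρ i hp)
  refine ⟨weightedOperatorSum ρ w hw Ψ, isLift_of_agreeAt
    (fun p => ∑ i ∈ ρ.finsupport p, (ρ i p * w i p) • Ψ i)
    (agreeAt_weightedOperatorSum ρ w hw Ψ) (fun p => ?_) (fun p f => ?_) (fun p x θ => ?_)
    fun p k hk => ?_⟩
  · rw [IsEven, Finset.mul_sum, Finset.sum_mul]
    exact Finset.sum_congr rfl fun i _ => (hΨe i).smul _
  · rw [Finset.mul_sum, Finset.sum_mul]
    exact Finset.sum_congr rfl fun i _ => by rw [smul_mul_assoc, mul_smul_comm, hΨf]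
  · have h1 : (∑ i ∈ ρ.finsupport p, (ρ i p * w i p) • Ψ i) * clifford x -
        clifford x * ∑ i ∈ ρ.finsupport p, (ρ i p * w i p) • Ψ i =
        ∑ i ∈ ρ.finsupport p, (ρ i p * w i p) • (mulFunction (g i) * clifford (φ x)) := by
      rw [Finset.mul_sum, Finset.sum_mul, ← Finset.sum_sub_distrib]
      refine Finset.sum_congr rfl fun i _ => ?_
      rw [smul_mul_assoc, mul_smul_comm, ← smul_sub, hΨx]
    have h2 : ∑ i ∈ ρ.finsupport p, (ρ i p * w i p) * evalAt p (g i) = 1 := by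
      rw [← ρ.sum_finsupport p (Set.mem_univ p)]
      refine Finset.sum_congr rfl fun i hi => ?_
      have : g i p ≠ 0 := hρ i (subset_tsupport _ ((ρ.mem_finsupport p).1 hi))
      exact (mul_assoc _ _ _).trans (by rw [evalAt_apply, inv_mul_cancel₀ this, mul_one])
    intro k v
    rw [h1]
    simp only [LinearMap.sum_apply, Forms.component_sum, DForm.sum_apply, map_sum,
      LinearMap.smul_apply, Forms.component_smul, AlternatingMap.smul_apply, map_smul, smul_eq_mul,
      Module.End.mul_apply, mulFunction_component, map_mul, ← mul_assoc, ← Finset.sum_mul]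
    rw [h2, one_mul]
  · simp only [LinearMap.sum_apply, Forms.component_sum, LinearMap.smul_apply,
      Forms.component_smul, hΨone _ k hk, smul_zero, Finset.sum_const_zero]

end Gluing

/-! ### Fibrewise and global polynomial identities -/

section Fibres
open Polynomial
variable {n : ℕ} {M : Type*} [TopologicalSpace M]
  [ChartedSpace (EuclideanSpace ℝ (Fin n)) M] [IsManifold (𝓡 n) ∞ M]

/-- A section that vanishes in every fibre is zero. -/
theorem eq_zero_of_forall_mem_vanishingIdeal_smul {x : GenTangentSection n M}
    (h : ∀ p : M, x ∈ (vanishingIdeal n p • ⊤ :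
      Submodule (SmoothFunction n M) (GenTangentSection n M))) : x = 0 := by
  have key : ∀ p : M, x.1 p = 0 ∧ ∀ Y, x.2 Y p = 0 := by
    intro p
    refine Submodule.smul_induction_on (h p) ?_ ?_
    · intro f hf y _
      have hf : f p = 0 := hf
      constructor
      · change f p • y.1 p = 0
        rw [hf, zero_smul]
      · intro Y
        change f p * y.2 Y p = 0
        rw [hf, zero_mul]
    · rintro y z ⟨hy, hy'⟩ ⟨hz, hz'⟩
      constructor
      · change y.1 p + z.1 p = 0
        rw [hy, hz, add_zero]
      · intro Y
        change y.2 Y p + z.2 Y p = 0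
        rw [hy', hz', add_zero]
  refine Prod.ext ?_ ?_
  · ext p
    exact (key p).1
  · ext Y p
    exact (key p).2 Y

theorem aeval_fibreMap_mk (φ : Module.End (SmoothFunction n M) (GenTangentSection n M)) (p : M)
    (P : ℝ[X]) (x : GenTangentSection n M) :
    aeval (fibreMap φ p) P (Submodule.Quotient.mk x) =
      Submodule.Quotient.mk (aeval (φ.restrictScalars ℝ) P x) := by
  exact aeval_apply_of_intertwine (V := GenTangentSection n M) (W := Fibre n p)
    ((Submodule.mkQ _).restrictScalars ℝ) (fun _ => rfl) P x

theorem IsGenPolynomialStructure.aeval_eq_zero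
    {φ : Module.End (SmoothFunction n M) (GenTangentSection n M)} {P : ℝ[X]}
    (hφ : IsGenPolynomialStructure φ P) : aeval (φ.restrictScalars ℝ) P = 0 := by
  refine LinearMap.ext fun x => eq_zero_of_forall_mem_vanishingIdeal_smul fun p => ?_
  rw [← Submodule.Quotient.mk_eq_zero, ← aeval_fibreMap_mk, ← hφ.minpoly_eq p, minpoly.aeval]
  rfl

/-- The tautological inner product is nondegenerate, as there are enough `1`-forms. -/
theorem eq_zero_of_forall_dot_eq_zero [T2Space M] {x : GenTangentSection n M}
    (h : ∀ y, dot x y = 0) : x = 0 := by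
  refine Prod.ext ?_ ?_
  · ext p
    obtain ⟨Y, α, g, hY, hg⟩ := exists_frame (n := n) p
    have h1 : ∀ i, α i x.1 = 0 := fun i => by simpa [dot] using h (0, α i)
    have h2 := hY x.1
    simp only [h1, zero_smul, Finset.sum_const_zero] at h2
    have h3 : g p • x.1 p = 0 := (congrArg (fun X : SmoothVectorField n M => X p) h2).symm
    exact (smul_eq_zero.1 h3).resolve_left hg
  · ext1 Y
    simpa [dot] using h (Y, 0)

theorem IsSkew.aeval_neg_eq_zero [T2Space M]
    {φ : Module.End (SmoothFunction n M) (GenTangentSection n M)} (hφ : IsSkew φ) {P : ℝ[X]}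
    (hP : aeval (φ.restrictScalars ℝ) P = 0) : aeval (-φ.restrictScalars ℝ) P = 0 := by
  refine LinearMap.ext fun x => eq_zero_of_forall_dot_eq_zero fun y => ?_
  have h := aeval_apply_of_adjoint (V := GenTangentSection n M) (W := SmoothFunction n M)
    (F := -φ.restrictScalars ℝ) (G := φ.restrictScalars ℝ) (dotBilinear _ _)
    (fun v w => ?_) P x y
  · rw [hP] at h
    exact h.trans (map_zero (dotBilinear _ _ x))
  · rw [LinearMap.neg_apply, map_neg, LinearMap.neg_apply]
    exact neg_eq_iff_eq_neg.2 (hφ.dot_left v w)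

end Fibres

end GeneralizedGeometry

end

theorem mainTheorem7 (n : ℕ) (M : Type*) [TopologicalSpace M] [T2Space M] [SigmaCompactSpace M]
    [ChartedSpace (EuclideanSpace ℝ (Fin n)) M] [IsManifold (𝓡 n) ∞ M]
    (φ : Module.End (GeneralizedGeometry.SmoothFunction n M)
      (GeneralizedGeometry.GenTangentSection n M))
    (P : Polynomial ℝ)
    (hφ : GeneralizedGeometry.IsGenPolynomialStructure φ P)
    (hss : GeneralizedGeometry.IsFibrewiseSemisimple φ)
    (hN : GeneralizedGeometry.IsWeakNijenhuis φ) :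
    GeneralizedGeometry.IsMinimal φ P := by
  obtain ⟨Φ, hΦ⟩ := GeneralizedGeometry.exists_isLift hφ.skew
  refine ⟨Φ, hΦ, fun x y => ?_⟩
  rcases isEmpty_or_nonempty M with hM | ⟨⟨p⟩⟩
  · -- On the empty manifold nothing is known about `P`, but every form vanishes.
    ext1 θ
    exact GeneralizedGeometry.forms_ext_of_agreeAt fun p => hM.elim p
  · have hP : Squarefree P := by
      rw [← hφ.minpoly_eq p]
      refine GeneralizedGeometry.squarefree_minpoly_of_isSemisimple (hss p) ?_
      rw [hφ.minpoly_eq p]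
      exact hφ.monic.ne_zero
    exact GeneralizedGeometry.derivedBracket_minimalOperator_eq_zero hΦ hN hP hφ.aeval_eq_zero
      (hφ.skew.aeval_neg_eq_zero hφ.aeval_eq_zero) x y
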